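/- Write $[r]=\{1,\dots,r\}$. A complete looped digraph $D$ on $[r]$ has every ordered pair $(i,j)\in[r]^2$ (including $i=j$) as an edge. Edge weights $d(i,j)\in[0,1]$ on $D$ are called $\epsilon$-complete if for each $j\in[r]$ we have $d(j,j)=1$ and, for all but at most $\epsilon r$ values of $i\in[r]\setminus\{j\}$, $d(i,j)+d(j,i)=1$. Given a digraph $F$ and weights $d$ on $D$, a function $\phi:V(F)\to[r]$ is a homomorphism from $F$ to $D$ if $d(\phi(v),\phi(w))>0$ whenever $vw\in E(F)$. For a real function $\beta$ and a finite set $A$ write $\beta(A)=\sum_{v\in A}\beta(v)$ and $\beta(v_1,\dots,v_k)=\beta(\{v_1,\dots,v_k\})$. For $a,b\in(0,1]$, $a\ll b$ means that there is a non-decreasing function $f:(0,1]\to(0,1]$ such that the subsequent statement holds whenever $a\le f(b)$. Let $H$ be the oriented forest with \begin{align*} V(H)=\{&x^+,y^+,z^+,u^+,w^+,\bar x^+,\bar z^+,\bar u^+,\bar w^+,x^-,y^-,z^-,u^-,w^-,\bar x^-,\bar z^-,\bar u^-,\bar w^-\},\\ E(H)=\{&x^+y^+,z^+x^+,z^+u^+,w^+z^+,\bar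 z^+\bar x^+,\bar z^+\bar u^+,\bar w^+\bar z^+,\\ &y^-x^-,x^-z^-,u^-z^-,z^-w^-,\bar x^-\bar z^-,\bar u^-\bar z^-,\bar z^-\bar w^-\}, \end{align*} where $vw$ denotes the edge directed from $v$ to $w$. Let $X^+=\{x^+,\bar x^+\}$, $X^-=\{x^-,\bar x^-\}$ and $X=X^+\cup X^-$. **Theorem.** Let $1/r\ll\epsilon\ll\mu\ll\alpha<1$. Let $\beta:V(H)\to[0,1]$ satisfy $\beta(V(H))=1$, $\beta(y^+)\ge\beta(x^+)$, $\beta(y^-)\ge\beta(x^-)$, and $\beta(v)\ge\mu$ for every $v\in V(H)$. Let $D$ be a complete looped digraph on vertex set $[r]$ with $\epsilon$-complete edge weights $d$. Let $$\gamma=\max\{\beta(x^+,\bar x^+),\beta(z^+,\bar z^+)\}+\max\{\beta(x^-,\bar x^-),\beta(z^-,\bar z^-)\}.$$ Then there are some $j_t\in[r]$ and a random function $\phi:V(H)\to[r]$ such that the following hold. 1. With probability $1$, $\phi$ is a homomorphism from $H$ to $D$ and $j_t\notin\phi(X)$. 2. For each $j\in[r]$, $\mathbb E(\beta(\phi^{-1}(j)))\le\frac{1+\gamma+\alpha}{r}$.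 3. For each $j\in[r]$, either - $\mathbb E(\beta(\phi^{-1}(j)\cap X^+))\le d(j_t,j)\cdot\frac{1+\gamma+\alpha}{r}$ and $\mathbb E(\beta(\phi^{-1}(j)\cap X))\le d(j,j_t)\cdot\frac{1+\gamma+\alpha}{r}$, or - $\mathbb E(\beta(\phi^{-1}(j)\cap X^-))\le d(j,j_t)\cdot\frac{1+\gamma+\alpha}{r}$ and $\mathbb E(\beta(\phi^{-1}(j)\cap X))\le d(j_t,j)\cdot\frac{1+\gamma+\alpha}{r}$. 4. With probability $1$, $|\phi(e)|=2$ for every $e\in E(H)$. -/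

import Mathlib

open scoped BigOperators

/-- Admissible functions in the hierarchy notation `a ≪ b`: non-decreasing functions
`f : (0,1] → (0,1]` (only the values of `f` on `(0,1]` matter). -/
def IsHierarchyFun (f : ℝ → ℝ) : Prop :=
  Set.MapsTo f (Set.Ioc 0 1) (Set.Ioc 0 1) ∧ MonotoneOn f (Set.Ioc 0 1)

/-- The vertex set of the oriented forest `H`. The suffix `p` stands for the superscript `+`,
the suffix `m` for the superscript `-`, and the infix `b` for a bar: `xbp` is `x̄⁺`. -/
inductive HVert : Type
  | xp | yp | zp | up | wp | xbp | zbp | ubp | wbp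
  | xm | ym | zm | um | wm | xbm | zbm | ubm | wbm
  deriving DecidableEq

instance : Fintype HVert where
  elems := {.xp, .yp, .zp, .up, .wp, .xbp, .zbp, .ubp, .wbp,
    .xm, .ym, .zm, .um, .wm, .xbm, .zbm, .ubm, .wbm}
  complete v := by cases v <;> decide

/-- The directed edges of `H`; the pair `(v, w)` is the edge `v → w`. -/
def HEdges : Finset (HVert × HVert) :=
  {(.xp, .yp), (.zp, .xp), (.zp, .up), (.wp, .zp),
   (.zbp, .xbp), (.zbp, .ubp), (.wbp, .zbp),
   (.ym, .xm), (.xm, .zm), (.um, .zm), (.zm, .wm),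
   (.xbm, .zbm), (.ubm, .zbm), (.zbm, .wbm)}

/-- The oriented forest `H`. -/
def H : Digraph HVert where
  Adj v w := (v, w) ∈ HEdges

/-- `X⁺ = {x⁺, x̄⁺}`. -/
def Xplus : Finset HVert := {.xp, .xbp}

/-- `X⁻ = {x⁻, x̄⁻}`. -/
def Xminus : Finset HVert := {.xm, .xbm}

/-- `X = X⁺ ∪ X⁻`. -/
def Xroot : Finset HVert := Xplus ∪ Xminus

/-- `β(A) = ∑_{v ∈ A} β(v)`. -/
def weight {V : Type*} (β : V → ℝ) (A : Finset V) : ℝ := ∑ v ∈ A, β v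

/-- `γ = max{β(x⁺,x̄⁺), β(z⁺,z̄⁺)} + max{β(x⁻,x̄⁻), β(z⁻,z̄⁻)}`. -/
noncomputable def gammaOf (β : HVert → ℝ) : ℝ :=
  max (weight β {.xp, .xbp}) (weight β {.zp, .zbp}) +
    max (weight β {.xm, .xbm}) (weight β {.zm, .zbm})

/-- `d` is a system of `ε`-complete edge weights on the complete looped digraph with vertex set
`[r]` (all ordered pairs `(i, j)`, including `i = j`, are edges): all weights lie in `[0,1]`,
every loop has weight `1`, and for every `j` all but at most `ε r` of the `i ≠ j` satisfy
`d(i,j) + d(j,i) = 1`. -/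
def IsEpsComplete (ε : ℝ) {r : ℕ} (d : Fin r → Fin r → ℝ) : Prop :=
  (∀ i j, d i j ∈ Set.Icc (0 : ℝ) 1) ∧
    ∀ j, d j j = 1 ∧ (Set.ncard {i : Fin r | i ≠ j ∧ d i j + d j i ≠ 1} : ℝ) ≤ ε * r

/-- `φ` is a homomorphism from the digraph `G` to the complete looped digraph on `[r]` with edge
weights `d`: every edge of `G` is mapped to an edge of positive weight. -/
def IsWeightedHom {V : Type*} (G : Digraph V) {r : ℕ} (d : Fin r → Fin r → ℝ)
    (φ : V → Fin r) : Prop :=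
  ∀ v w, G.Adj v w → 0 < d (φ v) (φ w)

/-- `E(β(φ⁻¹(j) ∩ A))`, where `φ` is a random function `V(H) → [r]` with law `P` (a probability
distribution on the finite set of all such functions). -/
noncomputable def expectedLoad {r : ℕ} (β : HVert → ℝ) (P : PMF (HVert → Fin r))
    (A : Finset HVert) (j : Fin r) : ℝ :=
  ∑ φ : HVert → Fin r, (P φ).toReal * weight β (A.filter fun v => φ v = j)

/-!
For a fixed vertex `jt = a`, asking for a random placement `φ` of `H` with the required expected loads
is a linear program. By duality (`exists_law_or_prices`) it is solvable unless there are prices on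
`[r]`, of mean at most `1` when the surcharges on `X⁺` and `X⁻` at `i` are discounted by `d a i` and
`d i a`, for which every placement avoiding `a` on `X` costs at least `1 + β(X) + μ`. So it suffices
to defeat such a system of prices, given one for each `a`, for a single `a`. As `β(X) ≤ γ` and
`μ ≤ α`, this is enough.

Since prices can be truncated at `3 / μ`, a random sample of boundedly many vertices keeps all the
price averages, and with high probability avoids the few pairs with `d i j + d j i ≠ 1`
(`exists_good_sample`). On the sample, `d` is a weighted tournament `t` on `n + 1` vertices: it
satisfies `t i j + t j i = 1`.

In a weighted tournament, the optimal strategy of the symmetric zero-sum game with payoff `t - 1/2`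
on a set `V` is a probability vector `p` to which every vertex of `V` sends average weight at least
`1/2`. Hence, for `j` in `V`, the vector `p` reweighted by `t(j, ·)` and normalized has density at
most `2 t(j, i)` with respect to `p`; it is where the root of a tree goes, and `p` is where the
other vertices go. The balance of `p` on its support yields Hall conditions between the two (`IsRootLoad`). Peeling off such strategies
layer by layer (`exists_peel`), once for each of the two halves of `H` with opposite orientations,
uses mass `n` out of `n + 1`, so some `j` survives and carries root loads for both halves. Against any
prices, the Hall conditions and a layer-cake argument (`sum_mul_le_of_superlevel`) produce a root
together with cheap neighbours (`IsRootLoad.exists_tree`). The root weight is charged twice, because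
of the density `2 t(j, i)`, which is where the factor `1 + β(X)` comes from
(`exists_root_forall_placement`).
-/

/-! ### Linear programming duality and symmetric games -/

/-- The alternative behind linear programming duality: either a probability vector on `Φ` makes all
the averages of `L` nonpositive, or some nonnegative prices make every row of `L` positive. -/
theorem lp_alternative {Φ I : Type*} [Fintype Φ] [Fintype I] (L : Φ → I → ℝ) :
    (∃ P : Φ → ℝ, (∀ φ, 0 ≤ P φ) ∧ ∑ φ, P φ = 1 ∧ ∀ i, ∑ φ, P φ * L φ i ≤ 0) ∨
    (∃ c : I → ℝ, (∀ i, 0 ≤ c i) ∧ ∀ φ, 0 < ∑ i, c i * L φ i) := by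
  classical
  -- the achievable vectors form a compact convex set, compared here with the nonpositive orthant
  let T : (Φ → ℝ) →ₗ[ℝ] (I → ℝ) := ∑ φ, (LinearMap.proj φ : (Φ → ℝ) →ₗ[ℝ] ℝ).smulRight (L φ)
  have hT : ∀ (P : Φ → ℝ) (i : I), T P i = ∑ φ, P φ * L φ i := by
    intro P i
    simp [T]
  by_cases h : Disjoint (T '' stdSimplex ℝ Φ) {x : I → ℝ | ∀ i, x i ≤ 0}
  · right
    have hcomp : IsCompact (T '' stdSimplex ℝ Φ) :=
      (isCompact_stdSimplex ℝ Φ).image T.continuous_of_finiteDimensional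
    have hcvx : Convex ℝ (T '' stdSimplex ℝ Φ) := (convex_stdSimplex ℝ Φ).linear_image T
    have hconv : Convex ℝ {x : I → ℝ | ∀ i, x i ≤ 0} := by
      intro x hx y hy a b ha hb _ i
      have h1 := mul_nonpos_of_nonneg_of_nonpos ha (hx i)
      have h2 := mul_nonpos_of_nonneg_of_nonpos hb (hy i)
      simp only [Pi.add_apply, Pi.smul_apply, smul_eq_mul]
      linarith
    have hclosed : IsClosed {x : I → ℝ | ∀ i, x i ≤ 0} := by
      simp only [Set.ofPred_forall]
      exact isClosed_iInter fun i => isClosed_le (continuous_apply i) continuous_const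
    obtain ⟨g, a, b, hga, hab, hgb⟩ :=
      geometric_hahn_banach_compact_closed hcvx hcomp hconv hclosed h
    have hb0 : b < 0 := by simpa using hgb 0 (by simp)
    have hrep : ∀ x : I → ℝ, g x = ∑ i, x i * g (Pi.single i 1) := by
      intro x
      conv_lhs => rw [pi_eq_sum_univ' x]
      simp [map_sum]
    refine ⟨fun i => -g (Pi.single i 1), fun i => ?_, fun φ => ?_⟩
    · by_contra hneg
      have hpos : 0 < g (Pi.single i 1) := by linarith
      -- scaling the negative coordinate direction makes the functional arbitrarily small
      have := hgb (Pi.single i (b / g (Pi.single i 1))) (by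
        intro k
        by_cases hk : k = i
        · subst hk; simpa using div_nonpos_of_nonpos_of_nonneg hb0.le hpos.le
        · simp [hk])
      rw [hrep] at this
      simp only [Pi.single_apply, ite_mul, zero_mul, Finset.sum_ite_eq', Finset.mem_univ,
        if_true] at this
      rw [div_mul_cancel₀ _ hpos.ne'] at this
      exact lt_irrefl _ this
    · have h1 := hga (L φ) ⟨Pi.single φ 1, single_mem_stdSimplex ℝ φ, by
        ext i
        simp [hT, Pi.single_apply]⟩
      rw [hrep] at h1
      have : ∑ i, -g (Pi.single i 1) * L φ i = -∑ i, L φ i * g (Pi.single i 1) := by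
        rw [← Finset.sum_neg_distrib]
        exact Finset.sum_congr rfl fun i _ => by ring
      rw [this]
      linarith
  · left
    obtain ⟨_, ⟨P, hP, rfl⟩, hx0⟩ := Set.not_disjoint_iff.1 h
    exact ⟨P, hP.1, hP.2, fun i => by rw [← hT]; exact hx0 i⟩

/-- The alternative for probability vectors supported in `S`. -/
theorem lp_alternative_on {Φ I : Type*} [Fintype Φ] [Fintype I] (S : Set Φ) (L : Φ → I → ℝ) :
    (∃ P : Φ → ℝ, (∀ φ, 0 ≤ P φ) ∧ (∀ φ, φ ∉ S → P φ = 0) ∧ ∑ φ, P φ = 1 ∧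
      ∀ i, ∑ φ, P φ * L φ i ≤ 0) ∨
    (∃ c : I → ℝ, (∀ i, 0 ≤ c i) ∧ ∀ φ ∈ S, 0 < ∑ i, c i * L φ i) := by
  classical
  rcases lp_alternative (fun φ : S => L φ) with ⟨P, hP0, hP1, hP⟩ | ⟨c, hc0, hc⟩
  · left
    have key : ∀ F : Φ → ℝ, ∑ φ, (if h : φ ∈ S then P ⟨φ, h⟩ else 0) * F φ
        = ∑ φ : S, P φ * F φ := by
      intro F
      rw [← Finset.sum_subset (Finset.subset_univ (Finset.univ.filter (· ∈ S)))
        (by intro φ _ hφ; simp at hφ; simp [hφ]), Finset.sum_subtype (p := (· ∈ S)) _ (by simp)]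
      exact Finset.sum_congr rfl fun φ _ => by simp
    refine ⟨fun φ => if h : φ ∈ S then P ⟨φ, h⟩ else 0, fun φ => ?_, fun φ hφ => by simp [hφ],
      ?_, fun i => ?_⟩
    · dsimp only; split_ifs; exacts [hP0 _, le_rfl]
    · have h2 := key fun _ => 1
      simp only [mul_one] at h2
      rw [h2, hP1]
    · rw [key fun φ => L φ i]
      exact hP i
  · exact Or.inr ⟨c, hc0, fun φ hφ => hc ⟨φ, hφ⟩⟩

/-- Optimal strategies of symmetric zero-sum games, played on a set `V`. -/
theorem exists_lottery {ι : Type*} [Fintype ι] (B : ι → ι → ℝ)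
    (hB : ∀ i j, B i j = -B j i) (V : Finset ι) (hV : V.Nonempty) :
    ∃ p : ι → ℝ, (∀ i, 0 ≤ p i) ∧ (∀ i, i ∉ V → p i = 0) ∧ ∑ i, p i = 1 ∧
      ∀ v ∈ V, 0 ≤ ∑ u, B v u * p u := by
  rcases lp_alternative_on (V : Set ι) (fun u (v : V) => -B v u) with
    ⟨p, hp0, hpV, hp1, hp⟩ | ⟨c, hc0, hc⟩
  · refine ⟨p, hp0, hpV, hp1, fun v hv => ?_⟩
    have h1 := hp ⟨v, hv⟩
    simp only [mul_neg, Finset.sum_neg_distrib] at h1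
    simp only [mul_comm (B v _)]
    linarith
  · exfalso
    have hz : ∑ u : V, c u * ∑ v : V, c v * -B v u = 0 := by
      have h1 : ∑ u : V, c u * ∑ v : V, c v * -B v u = ∑ u : V, ∑ v : V, c u * c v * B u v := by
        refine Finset.sum_congr rfl fun u _ => ?_
        rw [Finset.mul_sum]
        exact Finset.sum_congr rfl fun v _ => by rw [hB u v]; ring
      have h2 : ∑ u : V, ∑ v : V, c u * c v * B u v = -∑ u : V, ∑ v : V, c u * c v * B u v := by
        conv_lhs => rw [Finset.sum_comm]
        rw [← Finset.sum_neg_distrib]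
        refine Finset.sum_congr rfl fun u _ => ?_
        rw [← Finset.sum_neg_distrib]
        exact Finset.sum_congr rfl fun v _ => by rw [hB v u]; ring
      linarith
    have hall : ∀ u : V, c u = 0 := by
      intro u
      have := (Finset.sum_eq_zero_iff_of_nonneg (fun u _ => mul_nonneg (hc0 u) (hc u u.2).le)).1 hz u
        (Finset.mem_univ _)
      exact (mul_eq_zero.1 this).resolve_right (hc u u.2).ne'
    obtain ⟨v, hv⟩ := hV
    have := hc v hv
    simp [hall] at this

/-! ### Root loads in weighted tournaments -/

/-- A pair of masses for placing a tree with a distinguished root: `f` is available to all the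
vertices of the tree, and `A`, of the same total, describes where the root goes. The root sits on
out-neighbours of `j`, with density at most `2 t(j,i)` with respect to `f`. The last two fields are
Hall conditions: a set `M` with no edge to `W` (respectively from `W`) has root mass at most the
mass of `f` outside `W`, so that root mass can be matched along edges, in either direction, to
mass of `f`. All the conditions are additive and homogeneous in the pair `(f, A)`, and there is no
normalization of the total mass. -/
structure IsRootLoad {ι : Type*} [Fintype ι] (t : ι → ι → ℝ) (j : ι) (f A : ι → ℝ) : Prop where
  mass_nonneg : ∀ i, 0 ≤ f i
  root_nonneg : ∀ i, 0 ≤ A i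
  root_le : ∀ i, A i ≤ 2 * t j i * f i
  sum_eq : ∑ i, A i = ∑ i, f i
  hall_one : ∀ W M : Finset ι, (∀ w ∈ W, ∀ m ∈ M, t w m = 1) →
    ∑ m ∈ M, A m + ∑ w ∈ W, f w ≤ ∑ i, f i
  hall_zero : ∀ W M : Finset ι, (∀ w ∈ W, ∀ m ∈ M, t w m = 0) →
    ∑ m ∈ M, A m + ∑ w ∈ W, f w ≤ ∑ i, f i

namespace IsRootLoad

variable {ι : Type*} [Fintype ι] {t : ι → ι → ℝ} {j : ι} {f A g B : ι → ℝ}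

theorem zero : IsRootLoad t j (fun _ => 0) (fun _ => 0) := by
  constructor <;> simp

theorem add (h : IsRootLoad t j f A) (h' : IsRootLoad t j g B) :
    IsRootLoad t j (fun i => f i + g i) (fun i => A i + B i) where
  mass_nonneg i := add_nonneg (h.mass_nonneg i) (h'.mass_nonneg i)
  root_nonneg i := add_nonneg (h.root_nonneg i) (h'.root_nonneg i)
  root_le i := by linarith [h.root_le i, h'.root_le i]
  sum_eq := by simp only [Finset.sum_add_distrib, h.sum_eq, h'.sum_eq]
  hall_one W M hWM := by
    simp only [Finset.sum_add_distrib]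
    linarith [h.hall_one W M hWM, h'.hall_one W M hWM]
  hall_zero W M hWM := by
    simp only [Finset.sum_add_distrib]
    linarith [h.hall_zero W M hWM, h'.hall_zero W M hWM]

theorem smul (h : IsRootLoad t j f A) {c : ℝ} (hc : 0 ≤ c) :
    IsRootLoad t j (fun i => c * f i) (fun i => c * A i) where
  mass_nonneg i := mul_nonneg hc (h.mass_nonneg i)
  root_nonneg i := mul_nonneg hc (h.root_nonneg i)
  root_le i := by nlinarith [mul_le_mul_of_nonneg_left (h.root_le i) hc]
  sum_eq := by simp only [← Finset.mul_sum, h.sum_eq]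
  hall_one W M hWM := by
    simp only [← Finset.mul_sum]
    nlinarith [mul_le_mul_of_nonneg_left (h.hall_one W M hWM) hc]
  hall_zero W M hWM := by
    simp only [← Finset.mul_sum]
    nlinarith [mul_le_mul_of_nonneg_left (h.hall_zero W M hWM) hc]

end IsRootLoad

section Lottery

variable {ι : Type*} [Fintype ι]

/-- If every point of the support of `p` is in balance against `p`, then a set `W` that beats a
set `M` outright leaves little mass for `M`: the mass of `W` splits evenly against itself. -/
theorem two_mul_sum_add_sum_le_one [DecidableEq ι] {t : ι → ι → ℝ} (ht : ∀ i j, 0 ≤ t i j)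
    (hsum : ∀ i j, t i j + t j i = 1) {p : ι → ℝ} (hp : ∀ i, 0 ≤ p i)
    (hbal : ∀ w, p w ≠ 0 → ∑ u, t w u * p u = 1 / 2) {W M : Finset ι}
    (hWM : ∀ w ∈ W, ∀ m ∈ M, t w m = 1) (hW : ∑ w ∈ W, p w ≠ 0) :
    2 * ∑ m ∈ M, p m + ∑ w ∈ W, p w ≤ 1 := by
  have hdisj : Disjoint M W := by
    rw [Finset.disjoint_left]
    intro m hm hmW
    have h1 := hWM m hmW m hm
    have h2 := hsum m m
    linarith
  set S := ∑ w ∈ W, p w with hS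
  have hSpos : 0 < S := lt_of_le_of_ne (Finset.sum_nonneg fun w _ => hp w) hW.symm
  have hself : ∑ w ∈ W, ∑ u ∈ W, p w * (t w u * p u) = S * S / 2 := by
    have h1 : ∑ w ∈ W, ∑ u ∈ W, p w * (t w u * p u)
        + ∑ w ∈ W, ∑ u ∈ W, p w * (t w u * p u) = S * S := by
      conv_lhs => enter [2]; rw [Finset.sum_comm]
      rw [← Finset.sum_add_distrib, hS, Finset.sum_mul_sum]
      refine Finset.sum_congr rfl fun w _ => ?_
      rw [← Finset.sum_add_distrib]
      refine Finset.sum_congr rfl fun u _ => ?_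
      linear_combination p w * p u * hsum w u
    linarith
  have htot : ∑ w ∈ W, p w * ∑ u, t w u * p u = S / 2 := by
    rw [hS, Finset.sum_div]
    refine Finset.sum_congr rfl fun w _ => ?_
    by_cases hw : p w = 0
    · simp [hw]
    · rw [hbal w hw]; ring
  have hle : ∑ w ∈ W, p w * (∑ m ∈ M, p m + ∑ u ∈ W, t w u * p u)
      ≤ ∑ w ∈ W, p w * ∑ u, t w u * p u := by
    refine Finset.sum_le_sum fun w hw => mul_le_mul_of_nonneg_left ?_ (hp w)
    have h1 : ∑ m ∈ M, p m = ∑ m ∈ M, t w m * p m :=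
      Finset.sum_congr rfl fun m hm => by rw [hWM w hw m hm, one_mul]
    rw [h1, ← Finset.sum_union hdisj]
    exact Finset.sum_le_sum_of_subset_of_nonneg (Finset.subset_univ _)
      fun u _ _ => mul_nonneg (ht w u) (hp u)
  simp only [mul_add, Finset.sum_add_distrib, ← Finset.sum_mul] at hle
  simp only [Finset.mul_sum] at hle hself htot
  rw [hself, htot, ← hS, ← Finset.mul_sum] at hle
  by_contra hcon
  push Not at hcon
  nlinarith

/-- An optimal strategy `p` of the symmetric game with payoff `t - 1/2` on `V` carries a root load
for every vertex `j` of `V`, namely `p` reweighted by `t j` and normalized. Normalizing costs a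
factor of at most `2` because `j` sends average weight at least `1/2` to `p`, and the Hall conditions hold because
`p` is in balance against each point of its support. -/
theorem exists_lottery_rootLoad [DecidableEq ι] {t : ι → ι → ℝ} (ht : ∀ i j, 0 ≤ t i j)
    (hsum : ∀ i j, t i j + t j i = 1) (V : Finset ι) (hV : V.Nonempty) :
    ∃ p : ι → ℝ, (∀ i, 0 ≤ p i) ∧ (∀ i, i ∉ V → p i = 0) ∧ ∑ i, p i = 1 ∧
      ∀ j ∈ V, ∃ A, IsRootLoad t j p A := by
  obtain ⟨p, hp, hpV, hp1, hopt⟩ := exists_lottery (fun i j => t i j - 1 / 2)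
    (fun i j => by linarith [hsum i j]) V hV
  have hval : ∀ v, ∑ u, (t v u - 1 / 2) * p u = ∑ u, t v u * p u - 1 / 2 := by
    intro v
    simp only [sub_mul, Finset.sum_sub_distrib, ← Finset.mul_sum, hp1, mul_one]
  have hge : ∀ v ∈ V, 1 / 2 ≤ ∑ u, t v u * p u := by
    intro v hv
    have := hopt v hv
    rw [hval] at this
    linarith
  have hzero : ∑ v, p v * (∑ u, t v u * p u - 1 / 2) = 0 := by
    have h1 : ∑ v, ∑ u, p v * (t v u * p u) + ∑ v, ∑ u, p v * (t v u * p u) = 1 := by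
      conv_lhs => enter [2]; rw [Finset.sum_comm]
      rw [← Finset.sum_add_distrib]
      have : (1 : ℝ) = (∑ i, p i) * ∑ i, p i := by rw [hp1]; norm_num
      rw [this, Finset.sum_mul_sum]
      refine Finset.sum_congr rfl fun w _ => ?_
      rw [← Finset.sum_add_distrib]
      refine Finset.sum_congr rfl fun u _ => ?_
      linear_combination p w * p u * hsum w u
    simp only [mul_sub, Finset.sum_sub_distrib, ← Finset.sum_mul, hp1, Finset.mul_sum]
    linarith
  -- complementary slackness
  have hbal : ∀ v, p v ≠ 0 → ∑ u, t v u * p u = 1 / 2 := by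
    intro v hv
    have hnn : ∀ v ∈ Finset.univ, 0 ≤ p v * (∑ u, t v u * p u - 1 / 2) := by
      intro v _
      by_cases hvV : v ∈ V
      · exact mul_nonneg (hp v) (by linarith [hge v hvV])
      · simp [hpV v hvV]
    have h1 := (Finset.sum_eq_zero_iff_of_nonneg hnn).1 hzero v (Finset.mem_univ _)
    linarith [(mul_eq_zero.1 h1).resolve_left hv]
  have hbal' : ∀ v, p v ≠ 0 → ∑ u, t u v * p u = 1 / 2 := by
    intro v hv
    have h1 : ∑ u, t u v * p u = ∑ u, p u - ∑ u, t v u * p u := by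
      rw [← Finset.sum_sub_distrib]
      exact Finset.sum_congr rfl fun u _ => by linear_combination p u * hsum u v
    rw [h1, hp1, hbal v hv]; norm_num
  refine ⟨p, hp, hpV, hp1, fun j hj => ?_⟩
  set q := ∑ u, t j u * p u with hq
  have hqge : 1 / 2 ≤ q := hge j hj
  have hqpos : 0 < q := by linarith
  have hle : ∀ i, t j i * p i / q ≤ 2 * t j i * p i := by
    intro i
    rw [div_le_iff₀ hqpos]
    nlinarith [mul_nonneg (ht j i) (hp i)]
  have hsumA : ∑ i, t j i * p i / q = 1 := by
    rw [← Finset.sum_div, ← hq, div_self hqpos.ne']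
  have hnn : ∀ i, 0 ≤ t j i * p i / q := fun i =>
    div_nonneg (mul_nonneg (ht j i) (hp i)) hqpos.le
  have hall : ∀ W M : Finset ι,
      (∑ w ∈ W, p w ≠ 0 → 2 * ∑ m ∈ M, p m + ∑ w ∈ W, p w ≤ 1) →
      ∑ m ∈ M, t j m * p m / q + ∑ w ∈ W, p w ≤ ∑ i, p i := by
    intro W M h
    rw [hp1]
    by_cases hW : ∑ w ∈ W, p w = 0
    · rw [hW, add_zero, ← hsumA]
      exact Finset.sum_le_sum_of_subset_of_nonneg (Finset.subset_univ _) fun i _ _ => hnn i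
    · refine le_trans (add_le_add_left ?_ _) (h hW)
      rw [Finset.mul_sum]
      refine Finset.sum_le_sum fun m _ => (hle m).trans ?_
      nlinarith [hp m, hsum j m, ht m j]
  refine ⟨fun i => t j i * p i / q, hp, hnn, hle, by rw [hsumA, hp1], fun W M hWM => ?_,
    fun W M hWM => ?_⟩
  · exact hall W M (two_mul_sum_add_sum_le_one ht hsum hp hbal hWM)
  · exact hall W M (two_mul_sum_add_sum_le_one (t := fun i j => t j i) (fun i j => ht j i)
      (fun i j => hsum j i) hp hbal' fun w hw m hm => by linarith [hWM w hw m hm, hsum w m])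

/-- Peeling: mass `T` can be removed from `u` in layers, each an optimal strategy of the game on
what is left, so that every vertex that still has mass at the end carries a root load. -/
theorem exists_peel [DecidableEq ι] {t : ι → ι → ℝ} (ht : ∀ i j, 0 ≤ t i j)
    (hsum : ∀ i j, t i j + t j i = 1) (u : ι → ℝ) (hu : ∀ i, 0 ≤ u i) (T : ℝ) (hT : 0 ≤ T)
    (hTu : T ≤ ∑ i, u i) :
    ∃ f : ι → ℝ, (∀ i, 0 ≤ f i) ∧ (∀ i, f i ≤ u i) ∧ ∑ i, f i = T ∧
      ∀ j, f j < u j → ∃ A, IsRootLoad t j f A := by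
  induction hn : (Finset.univ.filter fun i => u i ≠ 0).card using Nat.strong_induction_on
    generalizing u T with
  | _ n ih =>
  subst hn
  rcases hT.eq_or_lt with rfl | hTpos
  · exact ⟨fun _ => 0, fun _ => le_rfl, hu, by simp, fun j _ => ⟨_, IsRootLoad.zero⟩⟩
  set V := Finset.univ.filter fun i => u i ≠ 0 with hVdef
  have hV : V.Nonempty := by
    by_contra hne
    rw [Finset.not_nonempty_iff_eq_empty] at hne
    have : ∑ i, u i = 0 := Finset.sum_eq_zero fun i _ => by
      by_contra hi
      have : i ∈ V := by simp [hVdef, hi]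
      simp [hne] at this
    linarith
  obtain ⟨p, hp, hpV, hp1, hload⟩ := exists_lottery_rootLoad ht hsum V hV
  have hP : (Finset.univ.filter fun i => 0 < p i).Nonempty := by
    by_contra hne
    rw [Finset.not_nonempty_iff_eq_empty, Finset.filter_eq_empty_iff] at hne
    have : ∑ i, p i ≤ 0 := Finset.sum_nonpos fun i hi => not_lt.1 (hne hi)
    linarith
  obtain ⟨v, hv, hvmin⟩ := Finset.exists_min_image _ (fun i => u i / p i) hP
  have hpv : 0 < p v := (Finset.mem_filter.1 hv).2
  -- `c` is the largest multiple of `p` that fits below `u`; removing it shrinks the support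
  set c := u v / p v with hc
  have hcp : ∀ i, c * p i ≤ u i := by
    intro i
    rcases (hp i).eq_or_lt with h0 | h0
    · simpa [← h0] using hu i
    · exact (le_div_iff₀ h0).1 (hvmin i (by simp [h0]))
  have hc0 : 0 ≤ c := div_nonneg (hu v) (hp v)
  have hmem : ∀ j, 0 < u j → j ∈ V := fun j hj => by simp [hVdef, hj.ne']
  rcases le_total T c with hTc | hcT
  · have hle : ∀ i, T * p i ≤ u i := fun i =>
      (mul_le_mul_of_nonneg_right hTc (hp i)).trans (hcp i)
    refine ⟨fun i => T * p i, fun i => mul_nonneg hT (hp i), hle, by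
      rw [← Finset.mul_sum, hp1, mul_one], fun j hj => ?_⟩
    obtain ⟨A, hA⟩ := hload j (hmem j ((mul_nonneg hT (hp j)).trans_lt hj))
    exact ⟨_, hA.smul hT⟩
  · have hcard : (Finset.univ.filter fun i => u i - c * p i ≠ 0).card < V.card := by
      refine Finset.card_lt_card (Finset.ssubset_iff_of_subset ?_ |>.2 ⟨v, ?_, ?_⟩)
      · intro i hi
        rw [Finset.mem_filter] at hi
        by_contra hiV
        have h0 : u i = 0 := by
          by_contra h0
          exact hiV (by simp [hVdef, h0])
        exact hi.2 (by rw [h0, hpV i hiV]; ring)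
      · by_contra hvV
        exact hpv.ne' (hpV v hvV)
      · simp [hc, div_mul_cancel₀ _ hpv.ne']
    obtain ⟨f, hf0, hfu, hfT, hf⟩ := ih _ hcard (fun i => u i - c * p i)
      (fun i => sub_nonneg.2 (hcp i)) (T - c) (sub_nonneg.2 hcT)
      (by rw [Finset.sum_sub_distrib, ← Finset.mul_sum, hp1]; linarith) rfl
    refine ⟨fun i => c * p i + f i, fun i => add_nonneg (mul_nonneg hc0 (hp i)) (hf0 i),
      fun i => by linarith [hfu i], by
        rw [Finset.sum_add_distrib, ← Finset.mul_sum, hp1, hfT]; ring, fun j hj => ?_⟩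
    obtain ⟨A, hA⟩ := hf j (by linarith)
    obtain ⟨B, hB⟩ := hload j (hmem j
      (lt_of_le_of_lt (add_nonneg (mul_nonneg hc0 (hp j)) (hf0 j)) hj))
    exact ⟨_, (hB.smul hc0).add hA⟩

end Lottery

/-! ### Cheap trees from root loads -/

/-- Layer-cake comparison of two weighted sums: a bound between the masses of all superlevel sets
integrates to a bound between the sums. -/
theorem sum_mul_le_of_superlevel {ι κ : Type*} [Fintype ι] [Fintype κ] {A g : ι → ℝ}
    {f h : κ → ℝ} {K E : ℝ} (hK : 0 ≤ K) (hg : ∀ i, g i ∈ Set.Icc 0 K)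
    (hh : ∀ i, h i ∈ Set.Icc 0 K)
    (hlev : ∀ τ, 0 ≤ τ → (∑ i, if τ < g i then A i else 0)
      ≤ (∑ i, if τ < h i then f i else 0) + E) :
    ∑ i, A i * g i ≤ ∑ i, f i * h i + E * K := by
  open MeasureTheory in
  have hind : ∀ a c : ℝ, (fun τ : ℝ => if τ < a then c else 0)
      = (Set.Iio a).indicator fun _ => c := by
    intro a c
    funext τ
    simp [Set.indicator_apply]
  have hconst : ∀ c : ℝ, IntegrableOn (fun _ : ℝ => c) (Set.Ico 0 K) := fun c =>
    integrableOn_const (by simp)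
  have hint : ∀ a c : ℝ, IntegrableOn (fun τ : ℝ => if τ < a then c else 0) (Set.Ico 0 K) := by
    intro a c
    rw [hind]
    exact (hconst c).indicator measurableSet_Iio
  have hval : ∀ a c : ℝ, a ∈ Set.Icc 0 K →
      ∫ τ in Set.Ico 0 K, (if τ < a then c else 0) = c * a := by
    intro a c ha
    rw [hind, setIntegral_indicator measurableSet_Iio, Set.Ico_inter_Iio, min_eq_right ha.2]
    simp [ha.1, mul_comm]
  have key : ∫ τ in Set.Ico 0 K, (∑ i, if τ < g i then A i else 0)
      ≤ ∫ τ in Set.Ico 0 K, ((∑ i, if τ < h i then f i else 0) + E) :=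
    setIntegral_mono_on (integrable_finsetSum _ fun i _ => hint _ _)
      ((integrable_finsetSum _ fun i _ => hint _ _).add (hconst E)) measurableSet_Ico
      fun τ hτ => hlev τ hτ.1
  rw [integral_add (integrable_finsetSum _ fun i _ => hint _ _) (hconst E),
    integral_finsetSum _ fun i _ => hint _ _, integral_finsetSum _ fun i _ => hint _ _] at key
  rw [Finset.sum_congr rfl fun i _ => hval _ _ (hg i),
    Finset.sum_congr rfl fun i _ => hval _ _ (hh i)] at key
  simpa [hK, mul_comm] using key

/-- `PosEdge t a b`: the pair `(a, b)` is a non-loop edge of positive weight. -/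
def PosEdge {ι : Type*} (t : ι → ι → ℝ) (a b : ι) : Prop := a ≠ b ∧ 0 < t a b


/-- In a weighted tournament at most one vertex of `W` has no out-neighbour in `W`. -/
theorem card_no_out_le_one {ι : Type*} {t : ι → ι → ℝ} (hsum : ∀ i j, t i j + t j i = 1) (W S : Finset ι)
    (hS : ∀ x ∈ S, x ∈ W ∧ ∀ w ∈ W, ¬ PosEdge t x w) : S.card ≤ 1 := by
  refine Finset.card_le_one.2 fun a ha b hb => ?_
  by_contra hab
  have h1 := (hS a ha).2 b (hS b hb).1
  have h2 := (hS b hb).2 a (hS a ha).1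
  simp only [PosEdge, not_and, not_lt] at h1 h2
  linarith [h1 hab, h2 (Ne.symm hab), hsum a b]

/-- In a weighted tournament at most one vertex of `W` has no in-neighbour in `W`. -/
theorem card_no_in_le_one {ι : Type*} {t : ι → ι → ℝ} (hsum : ∀ i j, t i j + t j i = 1) (W S : Finset ι)
    (hS : ∀ x ∈ S, x ∈ W ∧ ∀ w ∈ W, ¬ PosEdge t w x) : S.card ≤ 1 :=
  card_no_out_le_one (t := fun i j => t j i) (fun i j => hsum j i) W S fun x hx =>
    ⟨(hS x hx).1, fun w hw h => (hS x hx).2 w hw ⟨h.1.symm, h.2⟩⟩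

namespace IsRootLoad

variable {ι : Type*} [Fintype ι] {t : ι → ι → ℝ} {j : ι} {f A : ι → ℝ}

theorem root_le_two (hQ : IsRootLoad t j f A) (ht : ∀ i j, 0 ≤ t i j)
    (hsum : ∀ i j, t i j + t j i = 1) (hf : ∀ i, f i ≤ 1) (i : ι) : A i ≤ 2 := by
  nlinarith [hQ.root_le i, hsum i j, ht i j, ht j i, hf i, hQ.mass_nonneg i,
    mul_le_mul (show t j i ≤ 1 by linarith [hsum i j, ht i j]) (hf i) (hQ.mass_nonneg i)
      zero_le_one]

variable [DecidableEq ι]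

/-- The first Hall condition for the relation `PosEdge`, which excludes loops: at most one vertex of
`W` is affected by the difference, at a cost of at most `2`. -/
theorem sum_no_out (hQ : IsRootLoad t j f A) (ht : ∀ i j, 0 ≤ t i j)
    (hsum : ∀ i j, t i j + t j i = 1) (hf : ∀ i, f i ≤ 1) (W S : Finset ι)
    (hS : ∀ x ∈ S, ∀ w ∈ W, ¬ PosEdge t x w) :
    ∑ x ∈ S, A x + ∑ w ∈ W, f w ≤ ∑ i, f i + 2 := by
  have h1 : ∑ x ∈ S ∩ W, A x ≤ 2 := by
    have hc := card_no_out_le_one hsum W (S ∩ W) fun x hx =>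
      ⟨(Finset.mem_inter.1 hx).2, hS x (Finset.mem_inter.1 hx).1⟩
    have h2 := Finset.sum_le_card_nsmul (S ∩ W) A 2 fun i _ => hQ.root_le_two ht hsum hf i
    rw [nsmul_eq_mul] at h2
    have : ((S ∩ W).card : ℝ) ≤ 1 := by exact_mod_cast hc
    linarith
  have h2 := hQ.hall_one W (S \ W) fun w hw m hm => by
    rw [Finset.mem_sdiff] at hm
    have h3 := hS m hm.1 w hw
    simp only [PosEdge, not_and, not_lt] at h3
    have h4 := h3 fun h => hm.2 (h ▸ hw)
    linarith [hsum m w, ht m w]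
  linarith [Finset.sum_inter_add_sum_sdiff S W A]

/-- The second Hall condition for `PosEdge`, as in `IsRootLoad.sum_no_out`. -/
theorem sum_no_in (hQ : IsRootLoad t j f A) (ht : ∀ i j, 0 ≤ t i j)
    (hsum : ∀ i j, t i j + t j i = 1) (hf : ∀ i, f i ≤ 1) (W S : Finset ι)
    (hS : ∀ x ∈ S, ∀ w ∈ W, ¬ PosEdge t w x) :
    ∑ x ∈ S, A x + ∑ w ∈ W, f w ≤ ∑ i, f i + 2 := by
  have h1 : ∑ x ∈ S ∩ W, A x ≤ 2 := by
    have hc := card_no_in_le_one hsum W (S ∩ W) fun x hx =>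
      ⟨(Finset.mem_inter.1 hx).2, hS x (Finset.mem_inter.1 hx).1⟩
    have h2 := Finset.sum_le_card_nsmul (S ∩ W) A 2 fun i _ => hQ.root_le_two ht hsum hf i
    rw [nsmul_eq_mul] at h2
    have : ((S ∩ W).card : ℝ) ≤ 1 := by exact_mod_cast hc
    linarith
  have h2 := hQ.hall_zero W (S \ W) fun w hw m hm => by
    rw [Finset.mem_sdiff] at hm
    have h3 := hS m hm.1 w hw
    simp only [PosEdge, not_and, not_lt] at h3
    have h4 := h3 fun h => hm.2 (h ▸ hw)
    linarith [ht w m]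
  linarith [Finset.sum_inter_add_sum_sdiff S W A]

/-- The Hall condition for a branch `z → x`, `z → u`, `w → z` inside `W`: all but two vertices of `W`
have both an out-neighbour and an in-neighbour in `W`, so can serve as `z`. -/
theorem sum_no_branch (hQ : IsRootLoad t j f A) (ht : ∀ i j, 0 ≤ t i j)
    (hsum : ∀ i j, t i j + t j i = 1) (hf : ∀ i, f i ≤ 1) (W S : Finset ι)
    (hS : ∀ x ∈ S, ∀ z ∈ W, ∀ u ∈ W, ∀ w ∈ W,
      ¬ (PosEdge t z x ∧ PosEdge t z u ∧ PosEdge t w z)) :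
    ∑ x ∈ S, A x + ∑ w ∈ W, f w ≤ ∑ i, f i + 4 := by
  classical
  -- the vertices of `W` with an out-neighbour and an in-neighbour inside `W`
  set W₁ := W.filter fun z => ∃ u ∈ W, PosEdge t z u with hW₁
  set W₂ := W₁.filter fun z => ∃ w ∈ W, PosEdge t w z with hW₂
  have h0 := hQ.sum_no_in ht hsum hf W₂ S fun x hx z hz hzx => by
    simp only [hW₂, hW₁, Finset.mem_filter] at hz
    obtain ⟨⟨hzW, u, hu, hzu⟩, w, hw, hwz⟩ := hz
    exact hS x hx z hzW u hu w hw ⟨hzx, hzu, hwz⟩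
  have hle : ∀ U : Finset ι, U.card ≤ 1 → ∑ i ∈ U, f i ≤ 1 := by
    intro U hU
    have h2 := Finset.sum_le_card_nsmul U f 1 fun i _ => hf i
    rw [nsmul_eq_mul, mul_one] at h2
    exact h2.trans (by exact_mod_cast hU)
  have h1 : ∑ i ∈ W \ W₁, f i ≤ 1 := hle _ <| card_no_out_le_one hsum W _ fun x hx => by
    simp only [hW₁, Finset.mem_sdiff, Finset.mem_filter, not_and, not_exists] at hx
    exact ⟨hx.1, fun w hw h => hx.2 hx.1 w hw h⟩
  have h2 : ∑ i ∈ W₁ \ W₂, f i ≤ 1 := hle _ <| card_no_in_le_one hsum W _ fun x hx => by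
    simp only [hW₂, Finset.mem_sdiff, Finset.mem_filter, not_and, not_exists] at hx
    exact ⟨(Finset.mem_filter.1 hx.1).1, fun w hw h => hx.2 hx.1 w hw h⟩
  have h3 := Finset.sum_sdiff (f := f) (Finset.filter_subset _ _ : W₁ ⊆ W)
  have h4 := Finset.sum_sdiff (f := f) (Finset.filter_subset _ _ : W₂ ⊆ W₁)
  linarith

/-- The response to prices: a vertex carrying a root load admits a copy of the tree with edges
`x → y`, `z → x`, `z → u`, `w → z`, and root avoiding `j`, whose price is at most the price paid by
the root load, up to an additive error. -/
theorem exists_tree (hQ : IsRootLoad t j f A) (ht : ∀ i j, 0 ≤ t i j)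
    (hsum : ∀ i j, t i j + t j i = 1) (hf : ∀ i, f i ≤ 1) (hT : 8 < ∑ i, f i)
    {K : ℝ} (hK : 0 ≤ K) {h k : ι → ℝ} (hh : ∀ i, h i ∈ Set.Icc 0 K) (hk : ∀ i, 0 ≤ k i)
    {bx b_y bz bu bw : ℝ} (hbx : 0 ≤ bx) (hby : 0 ≤ b_y) (hbz : 0 ≤ bz) (hbu : 0 ≤ bu)
    (hbw : 0 ≤ bw) :
    ∃ x y z u w, PosEdge t x y ∧ PosEdge t z x ∧ PosEdge t z u ∧ PosEdge t w z ∧ x ≠ j ∧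
      (∑ i, f i - 8) * (bx * (h x + k x) + b_y * h y + (bz * h z + bu * h u + bw * h w))
        ≤ bx * ∑ i, A i * (h i + k i)
          + (b_y + (bz + bu + bw)) * (∑ i, f i * h i + 4 * K) := by
  classical
  set Val : Finset ι := Finset.univ.filter fun x => x ≠ j ∧ (∃ y, PosEdge t x y) ∧
    ∃ q : ι × ι × ι, PosEdge t q.1 x ∧ PosEdge t q.1 q.2.1 ∧ PosEdge t q.2.2 q.1 with hVal
  -- cheapest out-neighbour and cheapest branch at an admissible root
  have hy : ∀ x, ∃ y, x ∈ Val → PosEdge t x y ∧ ∀ y', PosEdge t x y' → h y ≤ h y' := by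
    intro x
    by_cases hx : x ∈ Val
    · obtain ⟨-, ⟨y₀, hy₀⟩, -⟩ := (Finset.mem_filter.1 hx).2
      obtain ⟨y, hy, hmin⟩ := Finset.exists_min_image
        (Finset.univ.filter fun y => PosEdge t x y) h ⟨y₀, by simpa using hy₀⟩
      exact ⟨y, fun _ => ⟨by simpa using hy, fun y' hy' => hmin y' (by simpa using hy')⟩⟩
    · exact ⟨x, fun h => absurd h hx⟩
  have hq : ∀ x, ∃ q : ι × ι × ι, x ∈ Val →
      (PosEdge t q.1 x ∧ PosEdge t q.1 q.2.1 ∧ PosEdge t q.2.2 q.1) ∧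
      ∀ q' : ι × ι × ι, (PosEdge t q'.1 x ∧ PosEdge t q'.1 q'.2.1 ∧ PosEdge t q'.2.2 q'.1) →
        max (h q.1) (max (h q.2.1) (h q.2.2)) ≤ max (h q'.1) (max (h q'.2.1) (h q'.2.2)) := by
    intro x
    by_cases hx : x ∈ Val
    · obtain ⟨-, -, q₀, hq₀⟩ := (Finset.mem_filter.1 hx).2
      obtain ⟨q, hq, hmin⟩ := Finset.exists_min_image
        (Finset.univ.filter fun q : ι × ι × ι =>
          PosEdge t q.1 x ∧ PosEdge t q.1 q.2.1 ∧ PosEdge t q.2.2 q.1)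
        (fun q => max (h q.1) (max (h q.2.1) (h q.2.2))) ⟨q₀, by simpa using hq₀⟩
      exact ⟨q, fun _ => ⟨by simpa using hq, fun q' hq' => hmin q' (by simpa using hq')⟩⟩
    · exact ⟨(x, x, x), fun h => absurd h hx⟩
  choose y hy using hy
  choose q hq using hq
  set Y : ι → ℝ := fun x => if x ∈ Val then h (y x) else 0 with hY
  set L : ι → ℝ := fun x => if x ∈ Val then
    max (h (q x).1) (max (h (q x).2.1) (h (q x).2.2)) else 0 with hL
  have hYK : ∀ x, Y x ∈ Set.Icc 0 K := by
    intro x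
    simp only [hY]
    split_ifs
    · exact hh _
    · exact ⟨le_rfl, hK⟩
  have hLK : ∀ x, L x ∈ Set.Icc 0 K := by
    intro x
    simp only [hL]
    split_ifs
    · exact ⟨(hh _).1.trans (le_max_left _ _), max_le (hh _).2 (max_le (hh _).2 (hh _).2)⟩
    · exact ⟨le_rfl, hK⟩
  have hsplit : ∀ τ, (∑ i, if τ < h i then f i else 0) + ∑ i ∈ Finset.univ.filter (h · ≤ τ), f i
      = ∑ i, f i := by
    intro τ
    rw [Finset.sum_filter, ← Finset.sum_add_distrib]
    refine Finset.sum_congr rfl fun i _ => ?_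
    by_cases hi : τ < h i
    · simp [hi]
    · simp [hi, not_lt.1 hi]
  have hAY : ∑ i, A i * Y i ≤ ∑ i, f i * h i + 2 * K := by
    refine sum_mul_le_of_superlevel hK hYK hh fun τ hτ => ?_
    rw [← Finset.sum_filter]
    have := hQ.sum_no_out ht hsum hf (Finset.univ.filter (h · ≤ τ))
      (Finset.univ.filter fun x => τ < Y x) fun x hx w hw hxw => by
        simp only [Finset.mem_filter, Finset.mem_univ, true_and, hY] at hx hw
        by_cases hxV : x ∈ Val
        · rw [if_pos hxV] at hx
          linarith [(hy x hxV).2 w hxw]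
        · rw [if_neg hxV] at hx
          linarith
    linarith [hsplit τ]
  have hAL : ∑ i, A i * L i ≤ ∑ i, f i * h i + 4 * K := by
    refine sum_mul_le_of_superlevel hK hLK hh fun τ hτ => ?_
    rw [← Finset.sum_filter]
    have := hQ.sum_no_branch ht hsum hf (Finset.univ.filter (h · ≤ τ))
      (Finset.univ.filter fun x => τ < L x) fun x hx z hz u hu w hw hzuw => by
        simp only [Finset.mem_filter, Finset.mem_univ, true_and, hL] at hx hz hu hw
        by_cases hxV : x ∈ Val
        · rw [if_pos hxV] at hx
          have h1 := (hq x hxV).2 (z, u, w) hzuw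
          have h2 : max (h z) (max (h u) (h w)) ≤ τ := max_le hz (max_le hu hw)
          dsimp only at h1
          linarith
        · rw [if_neg hxV] at hx
          linarith
    linarith [hsplit τ]
  -- the root load outside `Val` is bounded by the conditions above with `W` everything
  have hVmass : ∑ i, f i - 8 ≤ ∑ x ∈ Val, A x := by
    have h1 := hQ.sum_no_out ht hsum hf Finset.univ
      (Finset.univ.filter fun x => ∀ y, ¬ PosEdge t x y) fun x hx w _ =>
        (Finset.mem_filter.1 hx).2 w
    have h2 := hQ.sum_no_branch ht hsum hf Finset.univ
      (Finset.univ.filter fun x => ∀ q : ι × ι × ι,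
        ¬ (PosEdge t q.1 x ∧ PosEdge t q.1 q.2.1 ∧ PosEdge t q.2.2 q.1))
      fun x hx z _ u _ w _ => (Finset.mem_filter.1 hx).2 (z, u, w)
    have h3 := hQ.root_le_two ht hsum hf j
    have h4 : ∑ x ∈ Valᶜ, A x ≤ ∑ x ∈ ({j} : Finset ι), A x
        + ∑ x ∈ Finset.univ.filter (fun x => ∀ y, ¬ PosEdge t x y), A x
        + ∑ x ∈ Finset.univ.filter (fun x => ∀ q : ι × ι × ι,
          ¬ (PosEdge t q.1 x ∧ PosEdge t q.1 q.2.1 ∧ PosEdge t q.2.2 q.1)), A x := by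
      have hnn : ∀ i, 0 ≤ A i := hQ.root_nonneg
      have hsub : Valᶜ ⊆ ({j} ∪ Finset.univ.filter fun x => ∀ y, ¬ PosEdge t x y)
          ∪ Finset.univ.filter fun x => ∀ q : ι × ι × ι,
            ¬ (PosEdge t q.1 x ∧ PosEdge t q.1 q.2.1 ∧ PosEdge t q.2.2 q.1) := by
        intro x hx
        simp only [hVal, Finset.mem_compl, Finset.mem_filter, Finset.mem_univ, true_and,
          not_and_or, not_exists, Finset.mem_union, Finset.mem_singleton, not_not] at hx ⊢
        tauto
      refine (Finset.sum_le_sum_of_subset_of_nonneg hsub fun i _ _ => hnn i).trans ?_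
      have hun : ∀ S U : Finset ι, ∑ i ∈ S ∪ U, A i ≤ ∑ i ∈ S, A i + ∑ i ∈ U, A i := fun S U => by
        rw [← Finset.sum_union_inter]
        linarith [Finset.sum_nonneg fun i (_ : i ∈ S ∩ U) => hnn i]
      exact (hun _ _).trans (by gcongr; exact hun _ _)
    rw [Finset.sum_singleton] at h4
    have h5 := Finset.sum_add_sum_compl Val A
    have h6 := hQ.sum_eq
    linarith
  have hVne : Val.Nonempty := by
    by_contra hne
    rw [Finset.not_nonempty_iff_eq_empty] at hne
    rw [hne, Finset.sum_empty] at hVmass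
    linarith
  obtain ⟨x, hx, hmin⟩ := Finset.exists_min_image Val
    (fun x => bx * (h x + k x) + b_y * Y x + (bz + bu + bw) * L x) hVne
  have hc0 : ∀ x, 0 ≤ bx * (h x + k x) + b_y * Y x + (bz + bu + bw) * L x := fun x =>
    add_nonneg (add_nonneg (mul_nonneg hbx (add_nonneg (hh x).1 (hk x)))
      (mul_nonneg hby (hYK x).1)) (mul_nonneg (by positivity) (hLK x).1)
  refine ⟨x, y x, (q x).1, (q x).2.1, (q x).2.2, (hy x hx).1, (hq x hx).1.1, (hq x hx).1.2.1,
    (hq x hx).1.2.2, (Finset.mem_filter.1 hx).2.1, ?_⟩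
  have hYx : h (y x) = Y x := by simp only [hY, if_pos hx]
  have hLx : bz * h (q x).1 + bu * h (q x).2.1 + bw * h (q x).2.2 ≤ (bz + bu + bw) * L x := by
    simp only [hL, if_pos hx, add_mul]
    gcongr
    · exact le_max_left _ _
    · exact (le_max_left _ _).trans (le_max_right _ _)
    · exact (le_max_right _ _).trans (le_max_right _ _)
  calc (∑ i, f i - 8) * (bx * (h x + k x) + b_y * h (y x)
        + (bz * h (q x).1 + bu * h (q x).2.1 + bw * h (q x).2.2))
      ≤ (∑ i, f i - 8) * (bx * (h x + k x) + b_y * Y x + (bz + bu + bw) * L x) := by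
        rw [hYx]
        exact mul_le_mul_of_nonneg_left (by linarith) (by linarith)
    _ ≤ (∑ i ∈ Val, A i) * (bx * (h x + k x) + b_y * Y x + (bz + bu + bw) * L x) :=
        mul_le_mul_of_nonneg_right hVmass (hc0 x)
    _ ≤ ∑ i ∈ Val, A i * (bx * (h i + k i) + b_y * Y i + (bz + bu + bw) * L i) := by
        rw [Finset.sum_mul]
        exact Finset.sum_le_sum fun i hi =>
          mul_le_mul_of_nonneg_left (hmin i hi) (hQ.root_nonneg i)
    _ ≤ ∑ i, A i * (bx * (h i + k i) + b_y * Y i + (bz + bu + bw) * L i) :=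
        Finset.sum_le_sum_of_subset_of_nonneg (Finset.subset_univ _)
          fun i _ _ => mul_nonneg (hQ.root_nonneg i) (hc0 i)
    _ = bx * ∑ i, A i * (h i + k i) + b_y * ∑ i, A i * Y i
          + (bz + bu + bw) * ∑ i, A i * L i := by
        simp only [Finset.mul_sum, ← Finset.sum_add_distrib]
        exact Finset.sum_congr rfl fun i _ => by ring
    _ ≤ bx * ∑ i, A i * (h i + k i) + b_y * (∑ i, f i * h i + 4 * K)
          + (bz + bu + bw) * (∑ i, f i * h i + 4 * K) := by
        gcongr
        linarith
    _ = _ := by ring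

end IsRootLoad

/-! ### Placements of `H` in weighted tournaments -/

/-- `IsPlacement t j φ`: the edges of `H` go to non-loop edges of positive weight under `φ`, and
`φ` avoids `j` on `X`. -/
def IsPlacement {ι : Type*} (t : ι → ι → ℝ) (j : ι) (φ : HVert → ι) : Prop :=
  (∀ v w, H.Adj v w → PosEdge t (φ v) (φ w)) ∧ ∀ v ∈ Xroot, φ v ≠ j

/-- The price of `φ` when a vertex `v` placed at `i` pays `h i` per unit of weight, with surcharge
`kp i` on `X⁺` and `km i` on `X⁻`. -/
noncomputable def placementCost {ι : Type*} (β : HVert → ℝ) (h kp km : ι → ℝ) (φ : HVert → ι) : ℝ :=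
  ∑ v, β v * h (φ v) + ∑ v ∈ Xplus, β v * kp (φ v) + ∑ v ∈ Xminus, β v * km (φ v)

theorem HVert.sum_univ (F : HVert → ℝ) : ∑ v, F v =
    (F .xp + F .yp + F .zp + F .up + F .wp + (F .xbp + F .zbp + F .ubp + F .wbp)) +
    (F .xm + F .ym + F .zm + F .um + F .wm + (F .xbm + F .zbm + F .ubm + F .wbm)) := by
  have : (Finset.univ : Finset HVert) = {.xp, .yp, .zp, .up, .wp, .xbp, .zbp, .ubp, .wbp,
    .xm, .ym, .zm, .um, .wm, .xbm, .zbm, .ubm, .wbm} := rfl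
  rw [this]
  simp [Finset.sum_insert]
  ring

theorem sum_Xplus (F : HVert → ℝ) : ∑ v ∈ Xplus, F v = F .xp + F .xbp := by
  simp [Xplus]

theorem sum_Xminus (F : HVert → ℝ) : ∑ v ∈ Xminus, F v = F .xm + F .xbm := by
  simp [Xminus]

/-- One half of `H` placed from a root load: the charge is that of `f`, with root weights counted
twice and the surcharge at `i` discounted by `t j i`. -/
theorem IsRootLoad.exists_half {ι : Type*} [Fintype ι] [DecidableEq ι] {t : ι → ι → ℝ} {j : ι}
    {f A : ι → ℝ} (hQ : IsRootLoad t j f A) (ht : ∀ i j, 0 ≤ t i j)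
    (hsum : ∀ i j, t i j + t j i = 1) (hf : ∀ i, f i ≤ 1) (hT : 8 < ∑ i, f i)
    {K : ℝ} (hK : 0 ≤ K) {h k : ι → ℝ} (hh : ∀ i, h i ∈ Set.Icc 0 K) (hk : ∀ i, 0 ≤ k i)
    {bx b_y bz bu bw bx' bz' bu' bw' : ℝ} (hbx : 0 ≤ bx) (hby : 0 ≤ b_y) (hbz : 0 ≤ bz)
    (hbu : 0 ≤ bu) (hbw : 0 ≤ bw) (hbx' : 0 ≤ bx') (hbz' : 0 ≤ bz') (hbu' : 0 ≤ bu')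
    (hbw' : 0 ≤ bw') :
    ∃ x y z u w x' z' u' w', (PosEdge t x y ∧ PosEdge t z x ∧ PosEdge t z u ∧ PosEdge t w z) ∧
      (PosEdge t z' x' ∧ PosEdge t z' u' ∧ PosEdge t w' z') ∧ x ≠ j ∧ x' ≠ j ∧
      (∑ i, f i - 8) * (bx * (h x + k x) + b_y * h y + (bz * h z + bu * h u + bw * h w)
          + (bx' * (h x' + k x') + (bz' * h z' + bu' * h u' + bw' * h w')))
        ≤ (2 * (bx + bx') + (b_y + bz + bu + bw + bz' + bu' + bw'))
            * ∑ i, f i * (h i + t j i * k i)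
          + (bx + bx' + (b_y + bz + bu + bw + bz' + bu' + bw')) * (4 * K) := by
  obtain ⟨x, y, z, u, w, hxy, hzx, hzu, hwz, hxj, hcost⟩ :=
    hQ.exists_tree ht hsum hf hT hK hh hk hbx hby hbz hbu hbw
  obtain ⟨x', y', z', u', w', -, hzx', hzu', hwz', hxj', hcost'⟩ :=
    hQ.exists_tree ht hsum hf hT hK hh hk hbx' le_rfl hbz' hbu' hbw'
  refine ⟨x, y, z, u, w, x', z', u', w', ⟨hxy, hzx, hzu, hwz⟩, ⟨hzx', hzu', hwz'⟩, hxj, hxj', ?_⟩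
  have ht1 : ∀ i, t j i ≤ 1 := fun i => by linarith [hsum j i, ht i j]
  have hA : ∑ i, A i * (h i + k i) ≤ 2 * ∑ i, f i * (h i + t j i * k i) := by
    rw [Finset.mul_sum]
    refine Finset.sum_le_sum fun i _ => ?_
    have h1 : A i * h i ≤ 2 * f i * h i :=
      mul_le_mul_of_nonneg_right ((hQ.root_le i).trans (by
        nlinarith [mul_le_mul_of_nonneg_right (ht1 i) (hQ.mass_nonneg i)])) (hh i).1
    have h2 := mul_le_mul_of_nonneg_right (hQ.root_le i) (hk i)
    linarith
  have hF : ∑ i, f i * h i ≤ ∑ i, f i * (h i + t j i * k i) :=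
    Finset.sum_le_sum fun i _ => mul_le_mul_of_nonneg_left
      (by linarith [mul_nonneg (ht j i) (hk i)]) (hQ.mass_nonneg i)
  have h1 := mul_le_mul_of_nonneg_left hA (add_nonneg hbx hbx')
  have h2 := mul_le_mul_of_nonneg_left hF
    (show 0 ≤ b_y + bz + bu + bw + bz' + bu' + bw' by positivity)
  have h3 : 0 ≤ (bx + bx') * (4 * K) := by positivity
  linarith

/-- Large total mass absorbs the additive losses of `IsRootLoad.exists_half`. -/
theorem le_add_of_mass_large {K η c T b b' G C : ℝ} (hK : 0 ≤ K) (hη : 0 < η) (hc : 0 ≤ c)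
    (hT : 8 + 8 * (1 + K) / η ≤ T) (hb : 0 ≤ b) (hG : 0 ≤ G) (hcT : c * T = b')
    (hC : (T - 8) * C ≤ b' * G + b * (4 * K)) : C ≤ (1 + η) * c * G + η * b := by
  have h1 : 8 * (1 + K) ≤ (T - 8) * η := by
    rw [← div_le_iff₀ hη]; linarith
  have hT0 : 0 < T - 8 := by
    have : 0 < 8 * (1 + K) / η := by positivity
    linarith
  have h2 : T ≤ (1 + η) * (T - 8) := by nlinarith
  have h3 := mul_le_mul_of_nonneg_left h2 (mul_nonneg hc hG)
  have h4 : 4 * K * b ≤ (T - 8) * η * b := mul_le_mul_of_nonneg_right (by linarith) hb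
  rw [← hcT] at hC
  refine le_of_mul_le_mul_left (hC.trans ?_) hT0
  linarith

/-- Peeling twice, for the two orientations of `t`, from a unit of mass at each of `n + 1` vertices:
if at most `n` is taken away, some vertex survives and so carries root loads for both. -/
theorem exists_two_rootLoads {ι : Type*} [Fintype ι] [DecidableEq ι] {n : ℕ}
    (hcard : Fintype.card ι = n + 1) {t : ι → ι → ℝ} (ht : ∀ i j, 0 ≤ t i j)
    (hsum : ∀ i j, t i j + t j i = 1) {Tp Tm : ℝ} (hTp : 0 ≤ Tp) (hTm : 0 ≤ Tm)
    (hTsum : Tp + Tm = n) :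
    ∃ (j : ι) (fp Ap fm Am : ι → ℝ), IsRootLoad t j fp Ap ∧ IsRootLoad (fun i j => t j i) j fm Am ∧
      (∀ i, fp i + fm i ≤ 1) ∧ ∑ i, fp i = Tp ∧ ∑ i, fm i = Tm := by
  obtain ⟨fm, hfm0, hfm1, hfmT, hfm⟩ := exists_peel (t := fun i j => t j i) (fun i j => ht j i)
    (fun i j => hsum j i) (fun _ => 1) (fun _ => zero_le_one) Tm hTm
    (by simp [hcard]; linarith)
  obtain ⟨fp, hfp0, hfp1, hfpT, hfp⟩ := exists_peel ht hsum (fun i => 1 - fm i)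
    (fun i => by linarith [hfm1 i]) Tp hTp
    (by simp [Finset.sum_sub_distrib, hcard, hfmT]; linarith)
  obtain ⟨j, hj⟩ : ∃ j, fp j < 1 - fm j := by
    by_contra! hcon
    have h1 := Finset.sum_le_sum fun i (_ : i ∈ Finset.univ) => hcon i
    simp [Finset.sum_sub_distrib, hcard, hfmT, hfpT] at h1
    linarith
  obtain ⟨Ap, hAp⟩ := hfp j hj
  obtain ⟨Am, hAm⟩ := hfm j (by linarith [hfp0 j])
  exact ⟨j, fp, Ap, fm, Am, hAp, hAm, fun i => by linarith [hfp1 i], hfpT, hfmT⟩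

/-- Two halves make a placement of `H`. -/
theorem exists_placement_of_halves {ι : Type*} [Fintype ι] [DecidableEq ι] {t : ι → ι → ℝ} {j : ι}
    {fp Ap fm Am : ι → ℝ} (hAp : IsRootLoad t j fp Ap) (hAm : IsRootLoad (fun i j => t j i) j fm Am)
    (ht : ∀ i j, 0 ≤ t i j) (hsum : ∀ i j, t i j + t j i = 1) (hfp : ∀ i, fp i ≤ 1)
    (hfm : ∀ i, fm i ≤ 1) (hTp : 8 < ∑ i, fp i) (hTm : 8 < ∑ i, fm i)
    {β : HVert → ℝ} (hβ0 : ∀ v, 0 ≤ β v)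
    {K : ℝ} (hK : 0 ≤ K) {h kp km : ι → ℝ} (hh : ∀ i, h i ∈ Set.Icc 0 K) (hkp : ∀ i, 0 ≤ kp i)
    (hkm : ∀ i, 0 ≤ km i) :
    ∃ φ : HVert → ι, IsPlacement t j φ ∧ ∃ Cp Cm, placementCost β h kp km φ = Cp + Cm ∧
      (∑ i, fp i - 8) * Cp ≤ (2 * (β .xp + β .xbp) + (β .yp + β .zp + β .up + β .wp + β .zbp
          + β .ubp + β .wbp)) * ∑ i, fp i * (h i + t j i * kp i)
        + (β .xp + β .xbp + (β .yp + β .zp + β .up + β .wp + β .zbp + β .ubp + β .wbp))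
          * (4 * K) ∧
      (∑ i, fm i - 8) * Cm ≤ (2 * (β .xm + β .xbm) + (β .ym + β .zm + β .um + β .wm + β .zbm
          + β .ubm + β .wbm)) * ∑ i, fm i * (h i + t i j * km i)
        + (β .xm + β .xbm + (β .ym + β .zm + β .um + β .wm + β .zbm + β .ubm + β .wbm))
          * (4 * K) := by
  obtain ⟨xp, yp, zp, up, wp, xbp, zbp, ubp, wbp, ⟨e1, e2, e3, e4⟩, ⟨e5, e6, e7⟩, hxj, hxbj,
    hcostp⟩ := hAp.exists_half ht hsum hfp hTp hK hh
      hkp (hβ0 .xp) (hβ0 .yp) (hβ0 .zp) (hβ0 .up) (hβ0 .wp) (hβ0 .xbp) (hβ0 .zbp) (hβ0 .ubp)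
      (hβ0 .wbp)
  obtain ⟨xm, ym, zm, um, wm, xbm, zbm, ubm, wbm, ⟨g1, g2, g3, g4⟩, ⟨g5, g6, g7⟩, hxmj, hxbmj,
    hcostm⟩ := hAm.exists_half (fun i j => ht j i) (fun i j => hsum j i) hfm hTm hK hh
      hkm (hβ0 .xm) (hβ0 .ym) (hβ0 .zm) (hβ0 .um) (hβ0 .wm) (hβ0 .xbm) (hβ0 .zbm) (hβ0 .ubm)
      (hβ0 .wbm)
  have hrev : ∀ {a b}, PosEdge (fun i j => t j i) a b → PosEdge t b a := fun h =>
    ⟨h.1.symm, h.2⟩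
  refine ⟨fun v => match v with
    | .xp => xp | .yp => yp | .zp => zp | .up => up | .wp => wp
    | .xbp => xbp | .zbp => zbp | .ubp => ubp | .wbp => wbp
    | .xm => xm | .ym => ym | .zm => zm | .um => um | .wm => wm
    | .xbm => xbm | .zbm => zbm | .ubm => ubm | .wbm => wbm, ⟨?_, ?_⟩, _, _, ?_, hcostp, hcostm⟩
  · intro v w hvw
    simp only [H, HEdges, Finset.mem_insert, Finset.mem_singleton, Prod.mk.injEq] at hvw
    rcases hvw with ⟨rfl, rfl⟩ | ⟨rfl, rfl⟩ | ⟨rfl, rfl⟩ | ⟨rfl, rfl⟩ | ⟨rfl, rfl⟩ | ⟨rfl, rfl⟩ |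
      ⟨rfl, rfl⟩ | ⟨rfl, rfl⟩ | ⟨rfl, rfl⟩ | ⟨rfl, rfl⟩ | ⟨rfl, rfl⟩ | ⟨rfl, rfl⟩ | ⟨rfl, rfl⟩ |
      ⟨rfl, rfl⟩
    exacts [e1, e2, e3, e4, e5, e6, e7, hrev g1, hrev g2, hrev g3, hrev g4, hrev g5, hrev g6,
      hrev g7]
  · intro v hv
    simp only [Xroot, Xplus, Xminus, Finset.mem_union, Finset.mem_insert,
      Finset.mem_singleton] at hv
    rcases hv with (rfl | rfl) | (rfl | rfl)
    exacts [hxj, hxbj, hxmj, hxbmj]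
  rw [placementCost, HVert.sum_univ, sum_Xplus, sum_Xminus]
  ring

/-- The deterministic core: in a weighted tournament on `n + 1` vertices, some vertex `j` admits,
against every system of prices, a placement whose price is nearly at most the average price times
`1 + β(X)`, where the surcharges on `X⁺` and `X⁻` at `i` count with factors `t j i` and `t i j`. -/
theorem exists_root_forall_placement {ι : Type*} [Fintype ι] [DecidableEq ι] {n : ℕ}
    (hcard : Fintype.card ι = n + 1) {t : ι → ι → ℝ} (ht : ∀ i j, 0 ≤ t i j)
    (hsum : ∀ i j, t i j + t j i = 1) {β : HVert → ℝ} {μ : ℝ} (hμ : 0 < μ) (hβ : ∀ v, μ ≤ β v)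
    (hβ1 : ∑ v, β v = 1) {K η : ℝ} (hK : 0 ≤ K) (hη : 0 < η)
    (hn : 8 + 8 * (1 + K) / η ≤ n * μ / 2) :
    ∃ j : ι, ∀ h kp km : ι → ℝ, (∀ i, h i ∈ Set.Icc 0 K) → (∀ i, 0 ≤ kp i) → (∀ i, 0 ≤ km i) →
      ∃ φ : HVert → ι, IsPlacement t j φ ∧
        placementCost β h kp km φ ≤
          (1 + η) * ((1 + weight β Xroot) / n) *
            ∑ i, (h i + max (t j i * kp i) (t i j * km i)) + η := by
  have hβ0 : ∀ v, 0 ≤ β v := fun v => hμ.le.trans (hβ v)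
  obtain ⟨bp, hbp⟩ : ∃ b, b = β .xp + β .yp + β .zp + β .up + β .wp
    + (β .xbp + β .zbp + β .ubp + β .wbp) := ⟨_, rfl⟩
  obtain ⟨bm, hbm⟩ : ∃ b, b = β .xm + β .ym + β .zm + β .um + β .wm
    + (β .xbm + β .zbm + β .ubm + β .wbm) := ⟨_, rfl⟩
  obtain ⟨Xp, hXp⟩ : ∃ b, b = β .xp + β .xbp := ⟨_, rfl⟩
  obtain ⟨Xm, hXm⟩ : ∃ b, b = β .xm + β .xbm := ⟨_, rfl⟩
  have hb1 : bp + bm = 1 := by rw [hbp, hbm, ← HVert.sum_univ, hβ1]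
  have hX : weight β Xroot = Xp + Xm := by
    have : Disjoint Xplus Xminus := by decide
    rw [weight, Xroot, Finset.sum_union this, sum_Xplus, sum_Xminus, hXp, hXm]
  rw [hX]
  have hXp0 : 0 ≤ Xp := by rw [hXp]; exact add_nonneg (hβ0 _) (hβ0 _)
  have hXm0 : 0 ≤ Xm := by rw [hXm]; exact add_nonneg (hβ0 _) (hβ0 _)
  have hXbp : Xp ≤ bp := by
    rw [hXp, hbp]
    linarith [hβ0 .yp, hβ0 .zp, hβ0 .up, hβ0 .wp, hβ0 .zbp, hβ0 .ubp, hβ0 .wbp]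
  have hXbm : Xm ≤ bm := by
    rw [hXm, hbm]
    linarith [hβ0 .ym, hβ0 .zm, hβ0 .um, hβ0 .wm, hβ0 .zbm, hβ0 .ubm, hβ0 .wbm]
  have hμp : μ ≤ bp := by
    rw [hbp]
    linarith [hβ .xp, hβ0 .yp, hβ0 .zp, hβ0 .up, hβ0 .wp, hβ0 .xbp, hβ0 .zbp, hβ0 .ubp, hβ0 .wbp]
  have hμm : μ ≤ bm := by
    rw [hbm]
    linarith [hβ .xm, hβ0 .ym, hβ0 .zm, hβ0 .um, hβ0 .wm, hβ0 .xbm, hβ0 .zbm, hβ0 .ubm, hβ0 .wbm]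
  have hn0 : (0 : ℝ) < n := by
    by_contra hcon
    have : (n : ℝ) = 0 := le_antisymm (not_lt.1 hcon) (Nat.cast_nonneg n)
    rw [this] at hn
    have : 0 ≤ 8 * (1 + K) / η := by positivity
    linarith
  set c := (1 + (Xp + Xm)) / n with hc
  have hc0 : 0 < c := by positivity
  have hX0 : 0 < 1 + (Xp + Xm) := by positivity
  -- the two halves get their shares of the total mass `n`
  obtain ⟨Tp, hTp⟩ : ∃ T, T = n * (bp + Xp) / (1 + (Xp + Xm)) := ⟨_, rfl⟩
  obtain ⟨Tm, hTm⟩ : ∃ T, T = n * (bm + Xm) / (1 + (Xp + Xm)) := ⟨_, rfl⟩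
  have hTsum : Tp + Tm = n := by
    rw [hTp, hTm, ← add_div, div_eq_iff hX0.ne']
    linear_combination (n : ℝ) * hb1
  have hcTp : c * Tp = bp + Xp := by
    rw [hc, hTp]; field_simp
  have hcTm : c * Tm = bm + Xm := by
    rw [hc, hTm]; field_simp
  have hlow : ∀ b : ℝ, μ ≤ b → 8 + 8 * (1 + K) / η ≤ n * b / (1 + (Xp + Xm)) := by
    intro b hb
    refine hn.trans ?_
    rw [div_le_div_iff₀ two_pos hX0]
    exact mul_le_mul (mul_le_mul_of_nonneg_left hb hn0.le) (by linarith) hX0.le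
      (mul_nonneg hn0.le (hμ.le.trans hb))
  have hTp8 := hlow (bp + Xp) (by linarith)
  have hTm8 := hlow (bm + Xm) (by linarith)
  rw [← hTp] at hTp8
  rw [← hTm] at hTm8
  have hpos8 : 0 < 8 * (1 + K) / η := by positivity
  obtain ⟨j, fp, Ap, fm, Am, hAp, hAm, hf, hfpT, hfmT⟩ := exists_two_rootLoads hcard ht hsum
    (Tp := Tp) (Tm := Tm) (by linarith only [hTp8, hpos8]) (by linarith only [hTm8, hpos8]) hTsum
  refine ⟨j, fun h kp km hh hkp hkm => ?_⟩
  obtain ⟨φ, hφ, Cp, Cm, hC, hcostp, hcostm⟩ := exists_placement_of_halves hAp hAm ht hsum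
    (fun i => by linarith only [hf i, hAm.mass_nonneg i])
    (fun i => by linarith only [hf i, hAp.mass_nonneg i])
    (by linarith only [hfpT, hTp8, hpos8]) (by linarith only [hfmT, hTm8, hpos8]) hβ0 hK hh hkp hkm
  refine ⟨φ, hφ, ?_⟩
  rw [hC]
  rw [hfpT] at hcostp
  rw [hfmT] at hcostm
  set Gp := ∑ i, fp i * (h i + t j i * kp i) with hGp
  set Gm := ∑ i, fm i * (h i + t i j * km i) with hGm
  have hGp0 : 0 ≤ Gp := Finset.sum_nonneg fun i _ =>
    mul_nonneg (hAp.mass_nonneg i) (add_nonneg (hh i).1 (mul_nonneg (ht _ _) (hkp i)))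
  have hGm0 : 0 ≤ Gm := Finset.sum_nonneg fun i _ =>
    mul_nonneg (hAm.mass_nonneg i) (add_nonneg (hh i).1 (mul_nonneg (ht _ _) (hkm i)))
  have hp := le_add_of_mass_large hK hη hc0.le hTp8 (hμ.le.trans hμp) hGp0 hcTp
    (hcostp.trans (le_of_eq (by rw [hbp, hXp]; ring)))
  have hm := le_add_of_mass_large hK hη hc0.le hTm8 (hμ.le.trans hμm) hGm0 hcTm
    (hcostm.trans (le_of_eq (by rw [hbm, hXm]; ring)))
  have hG : Gp + Gm ≤ ∑ i, (h i + max (t j i * kp i) (t i j * km i)) := by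
    rw [hGp, hGm, ← Finset.sum_add_distrib]
    refine Finset.sum_le_sum fun i _ => ?_
    have hm0 : 0 ≤ h i + max (t j i * kp i) (t i j * km i) :=
      add_nonneg (hh i).1 (le_max_of_le_left (mul_nonneg (ht _ _) (hkp i)))
    have h1 := mul_le_mul_of_nonneg_left (add_le_add_right (le_max_left (t j i * kp i)
      (t i j * km i)) (h i)) (hAp.mass_nonneg i)
    have h2 := mul_le_mul_of_nonneg_left (add_le_add_right (le_max_right (t j i * kp i)
      (t i j * km i)) (h i)) (hAm.mass_nonneg i)
    have h3 := mul_le_mul_of_nonneg_right (hf i) hm0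
    linarith only [h1, h2, h3]
  have h5 := mul_le_mul_of_nonneg_left hG (show 0 ≤ (1 + η) * c by positivity)
  have h6 : η * bp + η * bm = η := by rw [← mul_add, hb1, mul_one]
  linarith only [hp, hm, h5, h6]

/-! ### Sampling a weighted tournament -/

/-- Summation over functions on `Fin (n + 1)` with one coordinate singled out. -/
theorem sum_pi_succAbove {r n : ℕ} (i : Fin (n + 1)) (F : Fin r → (Fin n → Fin r) → ℝ) :
    ∑ ω : Fin (n + 1) → Fin r, F (ω i) (fun l => ω (i.succAbove l)) = ∑ a, ∑ η, F a η := by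
  rw [← Fintype.sum_prod_type', ← (Fin.insertNthEquiv (fun _ => Fin r) i).sum_comp]
  simp

theorem sum_pi_eval {r n : ℕ} (l : Fin n) (g : Fin r → ℝ) :
    r * ∑ η : Fin n → Fin r, g (η l) = r ^ n * ∑ a, g a := by
  cases n with
  | zero => exact l.elim0
  | succ m =>
    rw [sum_pi_succAbove l fun a _ => g a]
    simp [Finset.mul_sum, pow_succ]
    exact Finset.sum_congr rfl fun i _ => by ring

/-- Chernoff bound for sums of `n` independent uniform samples of a function of mean at most `1`
with values in `[0, M]`. -/
theorem sum_exp_le {r n : ℕ} {M δ : ℝ} (hM : 1 ≤ M) (hδ : 0 < δ) (hδ1 : δ ≤ 1) {g : Fin r → ℝ}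
    (hg : ∀ b, g b ∈ Set.Icc 0 M) (hmean : ∑ b, g b ≤ r) :
    ∑ η : Fin n → Fin r, Real.exp (δ / (2 * M) * (∑ l, g (η l) - n * (1 + δ)))
      ≤ r ^ n * Real.exp (-(n * δ ^ 2 / (4 * M))) := by
  have hM0 : 0 < M := by linarith
  -- with this `lam`, the variance term `lam ^ 2 * M` is half of the gain `lam * δ`
  set lam := δ / (2 * M) with hlam
  have hlam0 : 0 < lam := by positivity
  have hlamM : lam * M = δ / 2 := by rw [hlam]; field_simp
  have h1 : ∑ b, Real.exp (lam * (g b - 1)) ≤ r * Real.exp (lam ^ 2 * M) := by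
    have hpt : ∀ b, Real.exp (lam * (g b - 1))
        ≤ 1 + lam * (g b - 1) + lam ^ 2 * ((M - 2) * g b + 1) := by
      intro b
      obtain ⟨h0, hb⟩ := hg b
      have hle : |lam * (g b - 1)| ≤ 1 := by
        rw [abs_le]
        constructor <;> nlinarith
      have h2 := (abs_le.1 (Real.abs_exp_sub_one_sub_id_le hle)).2
      have h3 : (lam * (g b - 1)) ^ 2 ≤ lam ^ 2 * ((M - 2) * g b + 1) := by
        rw [mul_pow]
        exact mul_le_mul_of_nonneg_left (by nlinarith) (sq_nonneg _)
      linarith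
    calc ∑ b, Real.exp (lam * (g b - 1))
        ≤ ∑ b, (1 + lam * (g b - 1) + lam ^ 2 * ((M - 2) * g b + 1)) :=
          Finset.sum_le_sum fun b _ => hpt b
      _ = r + lam * (∑ b, g b - r) + lam ^ 2 * ((M - 2) * ∑ b, g b + r) := by
          simp only [Finset.sum_add_distrib, ← Finset.mul_sum, Finset.sum_sub_distrib]
          simp
      _ ≤ r * (1 + lam ^ 2 * M) := by
          have h4 : 0 ≤ ∑ b, g b := Finset.sum_nonneg fun b _ => (hg b).1
          have h5 : (M - 2) * ∑ b, g b + r ≤ M * r := by nlinarith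
          have h6 := mul_le_mul_of_nonneg_left h5 (sq_nonneg lam)
          nlinarith
      _ ≤ r * Real.exp (lam ^ 2 * M) := by
          gcongr
          linarith [Real.add_one_le_exp (lam ^ 2 * M)]
  have h2 : ∀ η : Fin n → Fin r, Real.exp (lam * (∑ l, g (η l) - n * (1 + δ)))
      = (∏ l, Real.exp (lam * (g (η l) - 1))) * Real.exp (-(lam * (n * δ))) := by
    intro η
    rw [← Real.exp_sum, ← Real.exp_add, ← Finset.mul_sum, Finset.sum_sub_distrib]
    congr 1
    simp
    ring
  simp only [h2]
  rw [← Finset.sum_mul, ← Fintype.sum_pow (fun b => Real.exp (lam * (g b - 1)))]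
  calc (∑ b, Real.exp (lam * (g b - 1))) ^ n * Real.exp (-(lam * (n * δ)))
      ≤ (r * Real.exp (lam ^ 2 * M)) ^ n * Real.exp (-(lam * (n * δ))) := by
        gcongr
    _ = r ^ n * Real.exp (-(n * δ ^ 2 / (4 * M))) := by
        rw [mul_pow, ← Real.exp_nat_mul, mul_assoc, ← Real.exp_add]
        congr 2
        rw [hlam]
        field_simp
        ring

/-- First-moment sampling: `n + 1` uniform samples can be chosen with no pair in the sparse
relation `R`, and with the empirical mean of each price function close to its true mean. -/
theorem exists_good_sample {r n : ℕ} (hr : 0 < r) {R : Fin r → Fin r → Prop} {ρ : ℝ}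
    (hR : ∀ a, ({b | R a b}.ncard : ℝ) ≤ ρ * r) {M δ : ℝ} (hM : 1 ≤ M) (hδ : 0 < δ) (hδ1 : δ ≤ 1)
    {G : Fin r → Fin r → ℝ} (hG : ∀ a b, G a b ∈ Set.Icc 0 M) (hmean : ∀ a, ∑ b, G a b ≤ r)
    (hsmall : (n + 1) * Real.exp (-(n * δ ^ 2 / (4 * M))) + (n + 1) * (n * ρ) < 1) :
    ∃ ω : Fin (n + 1) → Fin r, (∀ i l, ¬ R (ω i) (ω (i.succAbove l))) ∧
      ∀ i, ∑ l, G (ω i) (ω (i.succAbove l)) ≤ n * (1 + δ) := by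
  classical
  have hr0 : (0 : ℝ) < r := by exact_mod_cast hr
  have hM0 : 0 < M := by linarith
  -- `E` is at least `1` when the empirical mean at `i` is too large, `D` when a pair is in `R`
  set E : (Fin (n + 1) → Fin r) → Fin (n + 1) → ℝ := fun ω i =>
    Real.exp (δ / (2 * M) * (∑ l, G (ω i) (ω (i.succAbove l)) - n * (1 + δ))) with hE
  set D : (Fin (n + 1) → Fin r) → Fin (n + 1) → Fin n → ℝ := fun ω i l =>
    if R (ω i) (ω (i.succAbove l)) then 1 else 0 with hD
  have hE0 : ∀ ω i, 0 ≤ E ω i := fun ω i => (Real.exp_pos _).le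
  have hD0 : ∀ ω i l, 0 ≤ D ω i l := fun ω i l => by
    simp only [hD]; split_ifs <;> norm_num
  have hEsum : ∀ i, ∑ ω, E ω i ≤ r ^ (n + 1) * Real.exp (-(n * δ ^ 2 / (4 * M))) := by
    intro i
    rw [sum_pi_succAbove i fun a η =>
      Real.exp (δ / (2 * M) * (∑ l, G a (η l) - n * (1 + δ)))]
    refine (Finset.sum_le_sum fun a _ => sum_exp_le hM hδ hδ1 (hG a) (hmean a)).trans
      (le_of_eq ?_)
    simp [pow_succ]
    ring
  have hDsum : ∀ i l, ∑ ω, D ω i l ≤ r ^ (n + 1) * ρ := by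
    intro i l
    rw [sum_pi_succAbove i fun a η => if R a (η l) then (1 : ℝ) else 0]
    refine le_of_mul_le_mul_left ?_ hr0
    rw [Finset.mul_sum]
    calc ∑ a, (r : ℝ) * ∑ η : Fin n → Fin r, (if R a (η l) then (1 : ℝ) else 0)
        = ∑ a, (r : ℝ) ^ n * ∑ b, if R a b then (1 : ℝ) else 0 :=
          Finset.sum_congr rfl fun a _ => sum_pi_eval l fun b => if R a b then (1 : ℝ) else 0
      _ ≤ ∑ a : Fin r, (r : ℝ) ^ n * (ρ * r) := by
          refine Finset.sum_le_sum fun a _ => mul_le_mul_of_nonneg_left ?_ (by positivity)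
          refine le_trans (le_of_eq ?_) (hR a)
          rw [Finset.sum_boole, Set.ncard_eq_toFinset_card']
          simp
      _ = r * (r ^ (n + 1) * ρ) := by
          simp only [Finset.sum_const, Finset.card_univ, Fintype.card_fin, nsmul_eq_mul]
          ring
  have htot : ∑ ω, (∑ i, E ω i + ∑ i, ∑ l, D ω i l) < ∑ ω : Fin (n + 1) → Fin r, (1 : ℝ) := by
    rw [Finset.sum_add_distrib, Finset.sum_comm, Finset.sum_comm (f := fun ω i => ∑ l, D ω i l)]
    have h1 := Finset.sum_le_sum fun i (_ : i ∈ Finset.univ) => hEsum i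
    have h2 : ∑ i, ∑ ω, ∑ l, D ω i l ≤ ∑ i : Fin (n + 1), ∑ l : Fin n, r ^ (n + 1) * ρ := by
      refine Finset.sum_le_sum fun i _ => ?_
      rw [Finset.sum_comm]
      exact Finset.sum_le_sum fun l _ => hDsum i l
    simp only [Finset.sum_const, Finset.card_univ, Fintype.card_fin, Fintype.card_pi,
      Finset.prod_const, nsmul_eq_mul, mul_one] at h1 h2 ⊢
    push_cast at h1 h2 ⊢
    have h3 := mul_lt_mul_of_pos_left hsmall (pow_pos hr0 (n + 1))
    linarith
  obtain ⟨ω, -, hω⟩ := Finset.exists_lt_of_sum_lt htot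
  have hs1 : 0 ≤ ∑ i, E ω i := Finset.sum_nonneg fun i _ => hE0 ω i
  have hs2 : 0 ≤ ∑ i, ∑ l, D ω i l :=
    Finset.sum_nonneg fun i _ => Finset.sum_nonneg fun l _ => hD0 ω i l
  refine ⟨ω, fun i l hRil => ?_, fun i => ?_⟩
  · have h1 : D ω i l ≤ ∑ i, ∑ l, D ω i l :=
      (Finset.single_le_sum (fun l _ => hD0 ω i l) (Finset.mem_univ l)).trans
        (Finset.single_le_sum (f := fun i => ∑ l, D ω i l)
          (fun i _ => Finset.sum_nonneg fun l _ => hD0 ω i l) (Finset.mem_univ i))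
    have h2 : D ω i l = 1 := by simp [hD, hRil]
    linarith
  · by_contra! hcon
    have h1 : E ω i ≤ ∑ i, E ω i := Finset.single_le_sum (fun i _ => hE0 ω i) (Finset.mem_univ i)
    have h2 : 1 ≤ E ω i := Real.one_le_exp (mul_nonneg (by positivity) (by linarith))
    linarith

/-- If every vertex `a` comes with bounded prices of mean at most `1`, then for some `a` there is a
placement of price less than `1 + β(X) + μ`: on a good sample of boundedly many vertices the weights
form a weighted tournament, and `exists_root_forall_placement` applies. -/
theorem exists_cheap_placement {r : ℕ} (hr : 0 < r) {μ ε : ℝ} (hμ : 0 < μ) (hμ1 : μ < 1)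
    (hε : ε ≤ μ ^ 12 / 10 ^ 16) (hrε : 1 / (r : ℝ) ≤ ε) {d : Fin r → Fin r → ℝ}
    (hd : IsEpsComplete ε d) {β : HVert → ℝ} (hβ : ∀ v, μ ≤ β v) (hβ1 : ∑ v, β v = 1)
    {h kp km : Fin r → Fin r → ℝ} (hh : ∀ a i, h a i ∈ Set.Icc 0 (3 / μ))
    (hkp : ∀ a i, kp a i ∈ Set.Icc 0 (3 / μ)) (hkm : ∀ a i, km a i ∈ Set.Icc 0 (3 / μ))
    (hmean : ∀ a, ∑ i, (h a i + max (d a i * kp a i) (d i a * km a i)) ≤ r) :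
    ∃ a φ, IsPlacement d a φ ∧
      placementCost β (h a) (kp a) (km a) φ < 1 + weight β Xroot + μ := by
  have hr0 : (0 : ℝ) < r := by exact_mod_cast hr
  have hd0 : ∀ i j, 0 ≤ d i j := fun i j => (hd.1 i j).1
  have hd1 : ∀ i j, d i j ≤ 1 := fun i j => (hd.1 i j).2
  -- the failure probabilities below are of order `1 / (n μ ^ 6)` and `n ^ 2 ε`; this `n` makes both
  -- small, given `ε ≤ μ ^ 12 / 10 ^ 16`
  obtain ⟨n, hn⟩ : ∃ n, n = ⌈2 * 10 ^ 7 / μ ^ 6⌉₊ := ⟨_, rfl⟩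
  have hμ6 : μ ^ 6 ≤ 1 := pow_le_one₀ hμ.le hμ1.le
  have hμ60 : 0 < μ ^ 6 := by positivity
  have hnlow : 2 * 10 ^ 7 ≤ n * μ ^ 6 := by
    rw [← div_le_iff₀ hμ60, hn]
    exact Nat.le_ceil _
  have hnup : (n + 1) * μ ^ 6 ≤ 2 * 10 ^ 7 + 2 := by
    have h1 : (n : ℝ) < 2 * 10 ^ 7 / μ ^ 6 + 1 := by
      rw [hn]
      exact Nat.ceil_lt_add_one (by positivity)
    have h2 := mul_lt_mul_of_pos_right h1 hμ60
    rw [add_mul, div_mul_cancel₀ _ hμ60.ne'] at h2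
    linarith
  have hn0 : (0 : ℝ) < n := by
    by_contra hcon
    have := mul_nonpos_of_nonpos_of_nonneg (not_lt.1 hcon) hμ60.le
    linarith
  have hμpow : ∀ k ≤ 6, 2 * 10 ^ 7 ≤ n * μ ^ k := fun k hk =>
    hnlow.trans (mul_le_mul_of_nonneg_left (pow_le_pow_of_le_one hμ.le hμ1.le hk) hn0.le)
  have hsmall : (n + 1) * Real.exp (-(n * (μ / 8) ^ 2 / (4 * (6 / μ))))
      + (n + 1) * (n * (2 * ε)) < 1 := by
    have hx : n * (μ / 8) ^ 2 / (4 * (6 / μ)) = n * μ ^ 3 / 1536 := by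
      field_simp
      ring
    rw [hx]
    set x := n * μ ^ 3 / 1536 with hxdef
    have hx0 : 0 < x := by positivity
    have h1 : Real.exp (-x) ≤ 2 / x ^ 2 := by
      rw [Real.exp_neg, ← one_div, div_le_div_iff₀ (Real.exp_pos _) (by positivity)]
      linarith [Real.quadratic_le_exp_of_nonneg hx0.le]
    have h2 : (n + 1) * Real.exp (-x) ≤ 1 / 2 := by
      have h3 : (n + 1) * (2 / x ^ 2) ≤ 1 / 2 := by
        have hn1 : (1 : ℝ) ≤ n := by
          have := hμpow 0 (by norm_num)
          rw [pow_zero] at this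
          linarith
        rw [mul_div_assoc', div_le_div_iff₀ (by positivity) two_pos, hxdef, div_pow, mul_pow,
          ← pow_mul]
        norm_num only
        nlinarith
      exact (mul_le_mul_of_nonneg_left h1 (by positivity)).trans h3
    have h4 : (n + 1) * (n * (2 * ε)) ≤ 1 / 4 := by
      have h5 : (n + 1) * (n * (2 * ε)) ≤ (n + 1) * ((n + 1) * (2 * (μ ^ 12 / 10 ^ 16))) := by
        have hε0 : 0 < ε := lt_of_lt_of_le (by positivity) hrε
        gcongr
        linarith
      have h6 : ((n + 1) * μ ^ 6) ^ 2 ≤ (2 * 10 ^ 7 + 2) ^ 2 :=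
        pow_le_pow_left₀ (by positivity) hnup 2
      have h7 : (n + 1) * ((n + 1) * (2 * (μ ^ 12 / 10 ^ 16)))
          = ((n + 1) * μ ^ 6) ^ 2 * (2 / 10 ^ 16) := by ring
      rw [h7] at h5
      norm_num at h6 h5 ⊢
      linarith
    linarith
  have hK1 : 1 ≤ 6 / μ := by rw [le_div_iff₀ hμ]; linarith
  obtain ⟨ω, hωR, hωG⟩ := exists_good_sample (n := n) hr (R := fun a b => d a b + d b a ≠ 1)
    (ρ := 2 * ε) (fun a => by
      have h1 : ({b | d a b + d b a ≠ 1} : Set (Fin r))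
          ⊆ insert a {i | i ≠ a ∧ d i a + d a i ≠ 1} := by
        intro b hb
        by_cases hba : b = a
        · exact Or.inl hba
        · exact Or.inr ⟨hba, by rw [add_comm]; exact hb⟩
      have h2 := (Set.ncard_le_ncard h1 (Set.toFinite _)).trans (Set.ncard_insert_le _ _)
      have h3 : (({b | d a b + d b a ≠ 1} : Set (Fin r)).ncard : ℝ)
          ≤ ({i | i ≠ a ∧ d i a + d a i ≠ 1} : Set (Fin r)).ncard + 1 := by exact_mod_cast h2
      have h4 := (hd.2 a).2
      have h5 : 1 ≤ ε * r := by rwa [div_le_iff₀ hr0] at hrε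
      linarith) hK1 (δ := μ / 8) (by positivity) (by linarith)
    (G := fun a i => h a i + max (d a i * kp a i) (d i a * km a i))
    (fun a i => by
      have h1 := mul_nonneg (hd0 a i) (hkp a i).1
      have h2 := mul_le_of_le_one_left (hkp a i).1 (hd1 a i)
      have h3 := mul_le_of_le_one_left (hkm a i).1 (hd1 i a)
      have h4 : (6 : ℝ) / μ = 3 / μ + 3 / μ := by ring
      refine ⟨add_nonneg (hh a i).1 (le_max_of_le_left h1), ?_⟩
      rw [h4]
      exact add_le_add (hh a i).2 (max_le (h2.trans (hkp a i).2) (h3.trans (hkm a i).2)))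
    hmean hsmall
  have hpair : ∀ i l, i ≠ l → d (ω i) (ω l) + d (ω l) (ω i) = 1 := by
    intro i l hil
    obtain ⟨l', rfl⟩ := Fin.exists_succAbove_eq hil.symm
    exact not_not.1 (hωR i l')
  have hinj : ∀ i l, i ≠ l → ω i ≠ ω l := by
    intro i l hil heq
    have h1 := hpair i l hil
    rw [heq, (hd.2 (ω l)).1] at h1
    norm_num at h1
  -- the sampled vertices form a weighted tournament, once loops are given weight `1/2`
  set t : Fin (n + 1) → Fin (n + 1) → ℝ := fun i l => if i = l then 1 / 2 else d (ω i) (ω l)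
    with ht
  have ht0 : ∀ i l, 0 ≤ t i l := by
    intro i l
    simp only [ht]
    split_ifs
    · norm_num
    · exact hd0 _ _
  have htsum : ∀ i l, t i l + t l i = 1 := by
    intro i l
    by_cases hil : i = l
    · simp only [ht, hil, if_true]; norm_num
    · simp only [ht, if_neg hil, if_neg (Ne.symm hil), hpair i l hil]
  have htd : ∀ {i l}, PosEdge t i l → PosEdge d (ω i) (ω l) := by
    rintro i l ⟨hil, hpos⟩
    simp only [ht, if_neg hil] at hpos
    exact ⟨hinj i l hil, hpos⟩
  obtain ⟨j, hj⟩ := exists_root_forall_placement (n := n) (by simp) ht0 htsum hμ hβ hβ1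
    (K := 3 / μ) (η := μ / 16) (by positivity) (by positivity) (by
      have h1 := hμpow 3 (by norm_num)
      have h2 : 8 + 8 * (1 + 3 / μ) / (μ / 16) = (8 * μ ^ 2 + 128 * μ + 384) / μ ^ 2 := by
        field_simp
        ring
      rw [h2, div_le_div_iff₀ (by positivity) two_pos]
      nlinarith)
  obtain ⟨φ, hφ, hcost⟩ := hj (fun i => h (ω j) (ω i)) (fun i => kp (ω j) (ω i))
    (fun i => km (ω j) (ω i)) (fun i => hh _ _) (fun i => (hkp _ _).1) (fun i => (hkm _ _).1)
  refine ⟨ω j, fun v => ω (φ v), ⟨fun v w hvw => htd (hφ.1 v w hvw),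
    fun v hv => hinj _ _ (hφ.2 v hv)⟩, ?_⟩
  have hcost' : placementCost β (h (ω j)) (kp (ω j)) (km (ω j)) (fun v => ω (φ v)) ≤ _ := hcost
  refine hcost'.trans_lt ?_
  set X := weight β Xroot with hX
  have hX0 : 0 ≤ X := Finset.sum_nonneg fun v _ => hμ.le.trans (hβ v)
  have hX1 : X ≤ 1 := by
    rw [← hβ1]
    exact Finset.sum_le_sum_of_subset_of_nonneg (Finset.subset_univ _)
      fun v _ _ => hμ.le.trans (hβ v)
  have hS : ∑ i, (h (ω j) (ω i) + max (t j i * kp (ω j) (ω i)) (t i j * km (ω j) (ω i)))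
      ≤ 6 / μ + n * (1 + μ / 8) := by
    rw [Fin.sum_univ_succAbove _ j]
    refine add_le_add ?_ (le_trans (le_of_eq ?_) (hωG j))
    · simp only [ht, if_true]
      have h1 := (hh (ω j) (ω j)).2
      have h2 := hkp (ω j) (ω j)
      have h3 := hkm (ω j) (ω j)
      have h4 : (6 : ℝ) / μ = 3 / μ + 3 / μ := by ring
      rw [h4]
      exact add_le_add h1 (max_le (by linarith [h2.1, h2.2]) (by linarith [h3.1, h3.2]))
    · refine Finset.sum_congr rfl fun l _ => ?_
      simp only [ht, if_neg (Fin.succAbove_ne j l), if_neg (Fin.succAbove_ne j l).symm]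
  have hc : (1 + X) / n * (6 / μ + n * (1 + μ / 8)) ≤ (1 + X) * (1 + μ / 8 + μ / 100) := by
    have h1 : (1 + X) / n * (6 / μ + n * (1 + μ / 8))
        = (1 + X) * (1 + μ / 8 + 6 / (n * μ)) := by
      field_simp
      ring
    rw [h1]
    have h2 : 6 / (n * μ) ≤ μ / 100 := by
      rw [div_le_div_iff₀ (by positivity) (by norm_num)]
      have := hμpow 2 (by norm_num)
      linarith
    gcongr
  have h1 : (1 + μ / 16) * ((1 + X) / n) *
      ∑ i, (h (ω j) (ω i) + max (t j i * kp (ω j) (ω i)) (t i j * km (ω j) (ω i)))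
      ≤ (1 + μ / 16) * ((1 + X) * (1 + μ / 8 + μ / 100)) := by
    rw [mul_assoc]
    refine mul_le_mul_of_nonneg_left (le_trans ?_ hc) (by positivity)
    exact mul_le_mul_of_nonneg_left hS (by positivity)
  refine lt_of_le_of_lt (add_le_add_left h1 _) ?_
  have h2 : X * μ ≤ μ := mul_le_of_le_one_left hμ.le hX1
  have h3 : X * (μ * μ) ≤ μ := by nlinarith
  nlinarith

/-! ### Duality for random placements -/

/-- Exchanging summation: the price of the loads of `A` is paid vertex by vertex of `H`. -/
theorem sum_mul_load {r : ℕ} (β : HVert → ℝ) (φ : HVert → Fin r) (A : Finset HVert)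
    (c : Fin r → ℝ) :
    ∑ j, c j * weight β (A.filter fun v => φ v = j) = ∑ v ∈ A, β v * c (φ v) := by
  simp only [weight, Finset.sum_filter, Finset.mul_sum]
  rw [Finset.sum_comm]
  refine Finset.sum_congr rfl fun v _ => ?_
  simp [mul_comm]

theorem placementCost_smul {ι : Type*} (β : HVert → ℝ) (h kp km : ι → ℝ) (s : ℝ)
    (φ : HVert → ι) :
    placementCost β (fun i => s * h i) (fun i => s * kp i) (fun i => s * km i) φ
      = s * placementCost β h kp km φ := by
  simp only [placementCost, mul_add, Finset.mul_sum, mul_left_comm]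

/-- Truncating prices at `K` keeps them expensive, as a single vertex paying `K` already
costs `μ K`. -/
theorem min_le_placementCost_min {ι : Type*} {β : HVert → ℝ} {μ K : ℝ} (hμ : 0 ≤ μ)
    (hβ : ∀ v, μ ≤ β v) (hK : 0 ≤ K) {h kp km : ι → ℝ} (hh : ∀ i, 0 ≤ h i) (hkp : ∀ i, 0 ≤ kp i)
    (hkm : ∀ i, 0 ≤ km i) (φ : HVert → ι) :
    min (placementCost β h kp km φ) (μ * K) ≤
      placementCost β (fun i => min (h i) K) (fun i => min (kp i) K) (fun i => min (km i) K) φ := by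
  have hβ0 : ∀ v, 0 ≤ β v := fun v => hμ.trans (hβ v)
  have hnn : ∀ (A : Finset HVert) (g : ι → ℝ), (∀ i, 0 ≤ g i) →
      ∀ v ∈ A, 0 ≤ β v * min (g (φ v)) K := fun A g hg v _ =>
    mul_nonneg (hβ0 v) (le_min (hg _) hK)
  have hbig : ∀ (A : Finset HVert) (g : ι → ℝ), (∀ i, 0 ≤ g i) →
      (∑ v ∈ A, β v * min (g (φ v)) K = ∑ v ∈ A, β v * g (φ v)) ∨
        μ * K ≤ ∑ v ∈ A, β v * min (g (φ v)) K := by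
    intro A g hg
    by_cases hA : ∀ v ∈ A, g (φ v) ≤ K
    · exact Or.inl (Finset.sum_congr rfl fun v hv => by rw [min_eq_left (hA v hv)])
    · push Not at hA
      obtain ⟨v, hv, hvK⟩ := hA
      refine Or.inr (le_trans ?_ (Finset.single_le_sum (hnn A g hg) hv))
      rw [min_eq_right hvK.le]
      exact mul_le_mul_of_nonneg_right (hβ v) hK
  have h1 := Finset.sum_nonneg (hnn Finset.univ h hh)
  have h2 := Finset.sum_nonneg (hnn Xplus kp hkp)
  have h3 := Finset.sum_nonneg (hnn Xminus km hkm)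
  rw [min_le_iff]
  simp only [placementCost]
  rcases hbig Finset.univ h hh with e1 | e1
  · rcases hbig Xplus kp hkp with e2 | e2
    · rcases hbig Xminus km hkm with e3 | e3
      · left; rw [e1, e2, e3]
      · right; linarith
    · right; linarith
  · right; linarith

/-- Linear programming duality for a fixed vertex `a`: either some random placement satisfies the
load bounds, or there are bounded prices of mean at most `1` for which every placement costs at
least `c`. Of the two options for the loads of `X⁺`, `X⁻` and `X` at `j`, the one that bounds the load
of `X` by the larger of `d a j` and `d j a` is imposed, so that all constraints are linear. -/
theorem exists_law_or_prices {r : ℕ} (hr : 0 < r) {d : Fin r → Fin r → ℝ}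
    (hd : ∀ i j, 0 ≤ d i j) (a : Fin r) {β : HVert → ℝ} {μ c q : ℝ} (hμ : 0 < μ)
    (hβ : ∀ v, μ ≤ β v) (hc : 0 < c) (hc3 : c ≤ 3) (hq : c / r ≤ q) :
    (∃ P : (HVert → Fin r) → ℝ, (∀ φ, 0 ≤ P φ) ∧ (∀ φ, ¬ IsPlacement d a φ → P φ = 0) ∧
      ∑ φ, P φ = 1 ∧
      (∀ j, ∑ φ, P φ * weight β (Finset.univ.filter fun v => φ v = j) ≤ q) ∧
      (∀ j, ∑ φ, P φ * weight β (Xroot.filter fun v => φ v = j) ≤ max (d a j) (d j a) * q) ∧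
      ∀ j, if d j a ≤ d a j
        then ∑ φ, P φ * weight β (Xminus.filter fun v => φ v = j) ≤ d j a * q
        else ∑ φ, P φ * weight β (Xplus.filter fun v => φ v = j) ≤ d a j * q) ∨
    ∃ h kp km : Fin r → ℝ, (∀ i, h i ∈ Set.Icc 0 (3 / μ)) ∧ (∀ i, kp i ∈ Set.Icc 0 (3 / μ)) ∧
      (∀ i, km i ∈ Set.Icc 0 (3 / μ)) ∧ ∑ i, (h i + max (d a i * kp i) (d i a * km i)) ≤ r ∧
      ∀ φ, IsPlacement d a φ → c ≤ placementCost β h kp km φ := by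
  classical
  have hr0 : (0 : ℝ) < r := by exact_mod_cast hr
  have hq0 : 0 < q := lt_of_lt_of_le (by positivity) hq
  rcases lp_alternative_on {φ : HVert → Fin r | IsPlacement d a φ}
    (fun φ => Sum.elim (fun j => weight β (Finset.univ.filter fun v => φ v = j) - q)
      (Sum.elim (fun j => weight β (Xroot.filter fun v => φ v = j) - max (d a j) (d j a) * q)
        (fun j => if d j a ≤ d a j
          then weight β (Xminus.filter fun v => φ v = j) - d j a * q
          else weight β (Xplus.filter fun v => φ v = j) - d a j * q)))
    with ⟨P, hP0, hPS, hP1, hP⟩ | ⟨y, hy0, hy⟩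
  · left
    have hsub : ∀ (F : (HVert → Fin r) → ℝ) (b : ℝ), ∑ φ, P φ * (F φ - b) ≤ 0 →
        ∑ φ, P φ * F φ ≤ b := by
      intro F b h
      simp only [mul_sub, Finset.sum_sub_distrib, ← Finset.sum_mul, hP1] at h
      linarith
    refine ⟨P, hP0, hPS, hP1, fun j => hsub _ _ (hP (Sum.inl j)),
      fun j => hsub _ _ (hP (Sum.inr (Sum.inl j))), fun j => ?_⟩
    have h3 := hP (Sum.inr (Sum.inr j))
    simp only [Sum.elim_inr] at h3
    split_ifs with hj
    · simp only [if_pos hj] at h3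
      exact hsub _ _ h3
    · simp only [if_neg hj] at h3
      exact hsub _ _ h3
  · right
    obtain ⟨h, hh⟩ : ∃ h : Fin r → ℝ, h = fun j => y (Sum.inl j) := ⟨_, rfl⟩
    obtain ⟨l, hl⟩ : ∃ h : Fin r → ℝ, h = fun j => y (Sum.inr (Sum.inl j)) := ⟨_, rfl⟩
    obtain ⟨k, hk⟩ : ∃ h : Fin r → ℝ, h = fun j => y (Sum.inr (Sum.inr j)) := ⟨_, rfl⟩
    have hh0 : ∀ j, 0 ≤ h j := fun j => by rw [hh]; exact hy0 _
    have hl0 : ∀ j, 0 ≤ l j := fun j => by rw [hl]; exact hy0 _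
    have hk0 : ∀ j, 0 ≤ k j := fun j => by rw [hk]; exact hy0 _
    -- the price `k` of the third constraint goes to the side that the constraint bounds
    set kp : Fin r → ℝ := fun j => l j + if d j a ≤ d a j then 0 else k j with hkp
    set km : Fin r → ℝ := fun j => l j + if d j a ≤ d a j then k j else 0 with hkm
    have hkp0 : ∀ j, 0 ≤ kp j := fun j =>
      add_nonneg (hl0 j) (by split_ifs; exacts [le_rfl, hk0 j])
    have hkm0 : ∀ j, 0 ≤ km j := fun j =>
      add_nonneg (hl0 j) (by split_ifs; exacts [hk0 j, le_rfl])
    set S := ∑ i, (h i + max (d a i * kp i) (d i a * km i)) with hS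
    have hS0 : 0 ≤ S := Finset.sum_nonneg fun i _ =>
      add_nonneg (hh0 i) (le_max_of_le_left (mul_nonneg (hd _ _) (hkp0 i)))
    have hcost : ∀ φ, IsPlacement d a φ → q * S < placementCost β h kp km φ := by
      intro φ hφ
      have h1 := hy φ hφ
      rw [Fintype.sum_sum_type, Fintype.sum_sum_type] at h1
      simp only [Sum.elim_inl, Sum.elim_inr] at h1
      have e1 : ∑ j, y (Sum.inl j) * (weight β (Finset.univ.filter fun v => φ v = j) - q)
          = ∑ v, β v * h (φ v) - ∑ j, h j * q := by
        rw [← sum_mul_load β φ Finset.univ h, ← Finset.sum_sub_distrib, hh]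
        exact Finset.sum_congr rfl fun j _ => by ring
      have e2 : ∑ j, y (Sum.inr (Sum.inl j)) *
          (weight β (Xroot.filter fun v => φ v = j) - max (d a j) (d j a) * q)
          = ∑ v ∈ Xroot, β v * l (φ v) - ∑ j, l j * (max (d a j) (d j a) * q) := by
        rw [← sum_mul_load β φ Xroot l, ← Finset.sum_sub_distrib, hl]
        exact Finset.sum_congr rfl fun j _ => by ring
      have e3 : ∑ j, y (Sum.inr (Sum.inr j)) * (if d j a ≤ d a j
          then weight β (Xminus.filter fun v => φ v = j) - d j a * q
          else weight β (Xplus.filter fun v => φ v = j) - d a j * q)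
          = ∑ v ∈ Xplus, β v * (if d (φ v) a ≤ d a (φ v) then 0 else k (φ v))
            + ∑ v ∈ Xminus, β v * (if d (φ v) a ≤ d a (φ v) then k (φ v) else 0)
            - ∑ j, k j * (min (d a j) (d j a) * q) := by
        rw [← sum_mul_load β φ Xplus fun j => if d j a ≤ d a j then 0 else k j,
          ← sum_mul_load β φ Xminus fun j => if d j a ≤ d a j then k j else 0,
          ← Finset.sum_add_distrib, ← Finset.sum_sub_distrib, hk]
        refine Finset.sum_congr rfl fun j _ => ?_
        split_ifs with hj
        · rw [min_eq_right hj]; ring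
        · rw [min_eq_left (not_le.1 hj).le]; ring
      have e4 : placementCost β h kp km φ = ∑ v, β v * h (φ v) + ∑ v ∈ Xroot, β v * l (φ v)
          + (∑ v ∈ Xplus, β v * (if d (φ v) a ≤ d a (φ v) then 0 else k (φ v))
            + ∑ v ∈ Xminus, β v * (if d (φ v) a ≤ d a (φ v) then k (φ v) else 0)) := by
        rw [Xroot, Finset.sum_union (by decide : Disjoint Xplus Xminus)]
        simp only [placementCost, hkp, hkm, mul_add, Finset.sum_add_distrib]
        ring
      have e5 : q * S ≤ ∑ j, h j * q + ∑ j, l j * (max (d a j) (d j a) * q)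
          + ∑ j, k j * (min (d a j) (d j a) * q) := by
        rw [hS, Finset.mul_sum, ← Finset.sum_add_distrib, ← Finset.sum_add_distrib]
        refine Finset.sum_le_sum fun j _ => ?_
        have h2 : max (d a j * kp j) (d j a * km j)
            ≤ l j * max (d a j) (d j a) + k j * min (d a j) (d j a) := by
          simp only [hkp, hkm]
          have m1 := mul_nonneg (hk0 j) (hd a j)
          have m2 := mul_nonneg (hk0 j) (hd j a)
          split_ifs with hj
          · rw [max_eq_left hj, min_eq_right hj]
            have m3 := mul_le_mul_of_nonneg_left hj (hl0 j)
            exact max_le (by linarith) (by linarith)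
          · rw [max_eq_right (not_le.1 hj).le, min_eq_left (not_le.1 hj).le]
            have m3 := mul_le_mul_of_nonneg_left (not_le.1 hj).le (hl0 j)
            exact max_le (by linarith) (by linarith)
        have h3 := mul_le_mul_of_nonneg_left h2 hq0.le
        linarith
      rw [e1, e2, e3] at h1
      rw [e4]
      linarith
    by_cases hne : ∃ φ, IsPlacement d a φ
    · obtain ⟨φ₀, hφ₀⟩ := hne
      obtain ⟨φ₁, hφ₁, hmin⟩ := Finset.exists_min_image
        (Finset.univ.filter fun φ : HVert → Fin r => IsPlacement d a φ)
        (placementCost β h kp km) ⟨φ₀, by simpa using hφ₀⟩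
      -- normalize the cheapest placement to price `c`
      set m := placementCost β h kp km φ₁ with hm
      have hmS : q * S < m := hcost φ₁ (Finset.mem_filter.1 hφ₁).2
      have hm0 : 0 < m := (mul_nonneg hq0.le hS0).trans_lt hmS
      set s := c / m with hs
      have hs0 : 0 < s := by positivity
      have hK : 0 ≤ 3 / μ := by positivity
      refine ⟨fun i => min (s * h i) (3 / μ), fun i => min (s * kp i) (3 / μ),
        fun i => min (s * km i) (3 / μ),
        fun i => ⟨le_min (mul_nonneg hs0.le (hh0 i)) hK, min_le_right _ _⟩,
        fun i => ⟨le_min (mul_nonneg hs0.le (hkp0 i)) hK, min_le_right _ _⟩,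
        fun i => ⟨le_min (mul_nonneg hs0.le (hkm0 i)) hK, min_le_right _ _⟩, ?_, fun φ hφ => ?_⟩
      · have h1 : ∑ i, (min (s * h i) (3 / μ) + max (d a i * min (s * kp i) (3 / μ))
            (d i a * min (s * km i) (3 / μ))) ≤ s * S := by
          rw [hS, Finset.mul_sum]
          refine Finset.sum_le_sum fun i _ => ?_
          rw [mul_add s (h i), mul_max_of_nonneg _ _ hs0.le]
          refine add_le_add (min_le_left _ _) (max_le_max ?_ ?_)
          · rw [mul_left_comm]
            exact mul_le_mul_of_nonneg_left (min_le_left _ _) (hd _ _)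
          · rw [mul_left_comm]
            exact mul_le_mul_of_nonneg_left (min_le_left _ _) (hd _ _)
        refine h1.trans ?_
        rw [div_le_iff₀ hr0] at hq
        rw [hs, div_mul_eq_mul_div, div_le_iff₀ hm0]
        have h2 := mul_le_mul_of_nonneg_right hq hS0
        have h3 := mul_le_mul_of_nonneg_left hmS.le hr0.le
        linarith
      · refine le_trans (le_min ?_ ?_) (min_le_placementCost_min hμ.le hβ hK
          (fun i => mul_nonneg hs0.le (hh0 i)) (fun i => mul_nonneg hs0.le (hkp0 i))
          (fun i => mul_nonneg hs0.le (hkm0 i)) φ)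
        · rw [placementCost_smul]
          have h1 := mul_le_mul_of_nonneg_left (hmin φ (by simpa using hφ)) hs0.le
          rwa [show s * m = c from div_mul_cancel₀ _ hm0.ne'] at h1
        · rwa [mul_div_cancel₀ _ hμ.ne']
    · have hK : (0 : ℝ) ∈ Set.Icc 0 (3 / μ) := ⟨le_rfl, by positivity⟩
      exact ⟨fun _ => 0, fun _ => 0, fun _ => 0, fun _ => hK, fun _ => hK, fun _ => hK,
        by simp, fun φ hφ => absurd ⟨φ, hφ⟩ hne⟩

theorem theorem3p2 :
    -- the hierarchy `1/r ≪ ε ≪ μ ≪ α`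
    ∃ f₁ f₂ f₃ : ℝ → ℝ, IsHierarchyFun f₁ ∧ IsHierarchyFun f₂ ∧ IsHierarchyFun f₃ ∧
      ∀ (α μ ε : ℝ) (r : ℕ), 0 < α → α < 1 → 0 < μ → μ ≤ f₃ α → 0 < ε → ε ≤ f₂ μ →
        0 < r → 1 / (r : ℝ) ≤ f₁ ε →
      ∀ β : HVert → ℝ, (∀ v, β v ∈ Set.Icc (0 : ℝ) 1) → weight β Finset.univ = 1 →
        β .xp ≤ β .yp → β .xm ≤ β .ym → (∀ v, μ ≤ β v) →
      ∀ d : Fin r → Fin r → ℝ, IsEpsComplete ε d →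
      ∃ (jt : Fin r) (P : PMF (HVert → Fin r)),
        -- almost surely `φ` is a homomorphism avoiding `jt` on `X`
        (∀ φ ∈ P.support, IsWeightedHom H d φ ∧ ∀ v ∈ Xroot, φ v ≠ jt) ∧
        -- total expected load
        (∀ j, expectedLoad β P Finset.univ j ≤ (1 + gammaOf β + α) / r) ∧
        -- expected loads of `X⁺`, `X⁻` and `X`
        (∀ j,
          (expectedLoad β P Xplus j ≤ d jt j * ((1 + gammaOf β + α) / r) ∧
            expectedLoad β P Xroot j ≤ d j jt * ((1 + gammaOf β + α) / r)) ∨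
          (expectedLoad β P Xminus j ≤ d j jt * ((1 + gammaOf β + α) / r) ∧
            expectedLoad β P Xroot j ≤ d jt j * ((1 + gammaOf β + α) / r))) ∧
        -- almost surely no edge of `H` is collapsed
        (∀ φ ∈ P.support, ∀ v w, H.Adj v w → (Finset.image φ {v, w}).card = 2) := by
  have hid : IsHierarchyFun fun x => x := ⟨fun x hx => hx, fun x _ y _ hxy => hxy⟩
  -- only `ε` against `μ` needs a quantitative choice, made for `exists_cheap_placement`
  refine ⟨fun x => x, fun x => x ^ 12 / 10 ^ 16, fun x => x, hid, ⟨fun x hx => ⟨?_, ?_⟩, ?_⟩, hid,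
    ?_⟩
  · have := hx.1
    positivity
  · have : x ^ 12 ≤ 1 := pow_le_one₀ hx.1.le hx.2
    rw [div_le_one (by norm_num)]
    linarith
  · intro x hx y _ hxy
    have := hx.1.le
    dsimp only
    gcongr
  intro α μ ε r _ hα1 hμ hμα _ hεμ hr hrε β _ hβ1 _ _ hβ d hd
  have hr0 : (0 : ℝ) < r := by exact_mod_cast hr
  have hd0 : ∀ i j, 0 ≤ d i j := fun i j => (hd.1 i j).1
  have hβ0 : ∀ v, 0 ≤ β v := fun v => hμ.le.trans (hβ v)
  have hX0 : 0 ≤ weight β Xroot := Finset.sum_nonneg fun v _ => hβ0 v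
  have hX1 : weight β Xroot ≤ 1 := by
    rw [← hβ1]
    exact Finset.sum_le_sum_of_subset_of_nonneg (Finset.subset_univ _) fun v _ _ => hβ0 v
  have hXγ : weight β Xroot ≤ gammaOf β := by
    rw [weight, Xroot, Finset.sum_union (by decide : Disjoint Xplus Xminus)]
    exact add_le_add (le_max_left _ _) (le_max_left _ _)
  set q := (1 + gammaOf β + α) / r with hq
  have hqX : (1 + weight β Xroot + μ) / r ≤ q := by
    rw [hq]
    gcongr
  obtain ⟨a, P, hP0, hPS, hP1, hload, hloadX, hloadpm⟩ : ∃ a, ∃ P : (HVert → Fin r) → ℝ,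
      (∀ φ, 0 ≤ P φ) ∧ (∀ φ, ¬ IsPlacement d a φ → P φ = 0) ∧ ∑ φ, P φ = 1 ∧
      (∀ j, ∑ φ, P φ * weight β (Finset.univ.filter fun v => φ v = j) ≤ q) ∧
      (∀ j, ∑ φ, P φ * weight β (Xroot.filter fun v => φ v = j) ≤ max (d a j) (d j a) * q) ∧
      ∀ j, if d j a ≤ d a j
        then ∑ φ, P φ * weight β (Xminus.filter fun v => φ v = j) ≤ d j a * q
        else ∑ φ, P φ * weight β (Xplus.filter fun v => φ v = j) ≤ d a j * q := by
    by_contra hno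
    rw [not_exists] at hno
    have hprices := fun a => (exists_law_or_prices hr hd0 a hμ hβ
      (by linarith : 0 < 1 + weight β Xroot + μ) (by linarith) hqX).resolve_left (hno a)
    choose h kp km hh hkp hkm hmean hcost using hprices
    obtain ⟨a, φ, hφ, hlt⟩ := exists_cheap_placement hr hμ (hμα.trans_lt hα1) hεμ hrε hd hβ hβ1
      hh hkp hkm hmean
    exact (hcost a φ hφ).not_gt hlt
  have hP1' : ∑ φ, ENNReal.ofReal (P φ) = 1 := by
    rw [← ENNReal.ofReal_sum_of_nonneg fun φ _ => hP0 φ, hP1, ENNReal.ofReal_one]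
  have hexp : ∀ A j, expectedLoad β (PMF.ofFintype (fun φ => ENNReal.ofReal (P φ)) hP1') A j
      = ∑ φ, P φ * weight β (A.filter fun v => φ v = j) := fun A j =>
    Finset.sum_congr rfl fun φ _ => by rw [PMF.ofFintype_apply, ENNReal.toReal_ofReal (hP0 φ)]
  have hsupp : ∀ φ ∈ (PMF.ofFintype (fun φ => ENNReal.ofReal (P φ)) hP1').support,
      IsPlacement d a φ := by
    intro φ hφ
    by_contra hno
    rw [PMF.mem_support_iff, PMF.ofFintype_apply, hPS φ hno] at hφ
    simp at hφ
  refine ⟨a, PMF.ofFintype (fun φ => ENNReal.ofReal (P φ)) hP1', fun φ hφ =>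
    ⟨fun v w hvw => ((hsupp φ hφ).1 v w hvw).2, (hsupp φ hφ).2⟩, fun j => ?_, fun j => ?_,
    fun φ hφ v w hvw => ?_⟩
  · rw [hexp]
    exact hload j
  · simp only [hexp]
    have h1 := hloadX j
    have h2 := hloadpm j
    split_ifs at h2 with hj
    · rw [max_eq_left hj] at h1
      exact Or.inr ⟨h2, h1⟩
    · rw [max_eq_right (not_le.1 hj).le] at h1
      exact Or.inl ⟨h2, h1⟩
  · rw [Finset.image_insert, Finset.image_singleton]
    exact Finset.card_pair ((hsupp φ hφ).1 v w hvw).1
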